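/- All algebras are unital over $\mathbb C$; repeated indices are summed. Let $\mathcal A=\mathrm{Poly}(H)$ be a Hopf algebra with comultiplication $\Delta$, counit $\epsilon$ and bijective antipode. A representation of $H$ is a matrix $v\in M_N(\mathcal A)$ with $\Delta v_{ij}=v_{ik}\otimes v_{kj}$ and $\epsilon(v_{ij})=\delta_{ij}$; $\mathrm{Mor}(v,w)$ is the set of complex matrices $M$ with $Mv=wM$; for matrices $v,w$ over an algebra, $(v\otimes w)_{ij,kl}=v_{ik}w_{jl}$; for $\rho\in\mathcal A'$ and $a\in\mathcal A$ put $a*\rho=(\rho\otimes\mathrm{id})\Delta a$ and $\rho*a=(\mathrm{id}\otimes\rho)\Delta a$. Let $\mathcal I$ be a finite set and $\Lambda=(\Lambda_{ij})_{i,j\in\mathcal I}$ a representation of $H$. Assume that every representation of $H$ is completely reducible, that $\Lambda$ is irreducible, and that $\mathrm{Mor}(v\otimes w,\Lambda\otimes v\otimes w)=\{0\}$ for all irreducible representations $v,w$ of $H$. Let $\mathcal B$ be a bialgebra containing $\mathcal A$ as a sub-bialgebra and let $p_i\in\mathcal B$ $(i\in\mathcal I)$ be such that: $\mathcal B$ is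 generated as an algebra by $\mathcal A$ and the $p_i$; the matrix $\mathcal P=\begin{pmatrix}\Lambda&p\\0&I\end{pmatrix}$ satisfies $\Delta\mathcal P_{ij}=\mathcal P_{ik}\otimes\mathcal P_{kj}$, $\epsilon(\mathcal P_{ij})=\delta_{ij}$; some $p_i\notin\mathcal A$; and $\Gamma\mathcal A\subset\Gamma$, where $\Gamma=\mathcal A\cdot\mathrm{span}\{p_i\}+\mathcal A$. Then there are unique functionals $f_{st}\in\mathcal A'$ with $p_sa-(a*f_{st})p_t\in\mathcal A$ for all $s\in\mathcal I$, $a\in\mathcal A$. Put $R_{ij,sm}=f_{im}(\Lambda_{js})$, and let $\mathbf 1$ denote unit matrices. Assume that $R^2=\mathbf 1$ and that, for every $x\in\mathbb C^{\mathcal I\times\mathcal I}$, $$x(R+\mathbf 1)=0\iff x_{ij}p_ip_j\in\Gamma$$ (that is, $\mathcal B$ has as many relations $x_{ij}p_ip_j+b_ip_i+c=0$ with $b_i,c\in\mathcal A$ as possible). Then there are functionals $\eta_s\in\mathcal A'$ and numbers $T_{ij}\in\mathbb C$ such that $\Lambda_{st}(f_{tr}*a)=(a*f_{st})\Lambda_{tr}$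 for all $a\in\mathcal A$, the map $a\mapsto\begin{pmatrix}f(a)&\eta(a)\\0&\epsilon(a)\end{pmatrix}$ is a unital homomorphism, and the relations (1) and (2) below hold in $\mathcal B$. Moreover, for any $\eta$ and $T$ for which (1) and (2) hold in $\mathcal B$: a) $\mathcal B$ is the universal unital algebra generated by $\mathcal A$ and $p_i$ $(i\in\mathcal I)$ with the relations $I_{\mathcal B}=I_{\mathcal A}$, $$p_sa=(a*f_{st})p_t+a*\eta_s-\Lambda_{st}(\eta_t*a),\qquad s\in\mathcal I,\ a\in\mathcal A,\tag{1}$$ $$(R-\mathbf 1)_{kl,ij}\bigl(p_ip_j-\eta_i(\Lambda_{js})p_s+T_{ij}-\Lambda_{im}\Lambda_{jn}T_{mn}\bigr)=0,\qquad k,l\in\mathcal I.\tag{2}$$ b) $\mathcal B$ is the universal unital algebra generated by $\mathcal A$ and $p_i$ $(i\in\mathcal I)$ with the relations $I_{\mathcal B}=I_{\mathcal A}$, $$(\mathcal P\otimes w)N_w=N_w(w\otimes\mathcal P)\quad\text{for every representation } w \text{ of } H,$$ $$R_P(\mathcal P\otimes\mathcal P)=(\mathcal P\otimes\mathcal P)R_P,$$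 where $$R_P=\begin{pmatrix}R&Z&-RZ&(R-\mathbf 1)T\\0&0&\mathbf 1&0\\0&\mathbf 1&0&0\\0&0&0&1\end{pmatrix},\qquad N_w=\begin{pmatrix}G_w&H_w\\0&\mathbf 1\end{pmatrix},$$ $(G_w)_{iC,Dj}=f_{ij}(w_{CD})$, $(H_w)_{iC,D}=\eta_i(w_{CD})$, $R=G_\Lambda$, $Z=H_\Lambda$; the blocks of $R_P$ correspond to the decomposition of $(\mathbb C^{\mathcal I}\oplus\mathbb C)^{\otimes2}$ into $\mathbb C^{\mathcal I}\otimes\mathbb C^{\mathcal I}$, $\mathbb C^{\mathcal I}\otimes\mathbb C$, $\mathbb C\otimes\mathbb C^{\mathcal I}$, $\mathbb C\otimes\mathbb C$, in this order. -/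

import Mathlib

universe w u v x

open scoped TensorProduct Kronecker

namespace InhomQG

noncomputable section

/-! ### Representations (finite-dimensional matrix corepresentations) of a bialgebra over `ℂ` -/

section Rep

variable {A : Type*} [Ring A] [Bialgebra ℂ A]

/-- `v` is a representation: `Δ v_ij = ∑ₖ v_ik ⊗ v_kj` and `ε(v_ij) = δ_ij`. -/
def IsRep {n : Type*} [Fintype n] [DecidableEq n] (v : Matrix n n A) : Prop :=
  (∀ i j, Coalgebra.comul (R := ℂ) (v i j) = ∑ k, v i k ⊗ₜ[ℂ] v k j) ∧
    ∀ i j, Coalgebra.counit (R := ℂ) (v i j) = (1 : Matrix n n ℂ) i j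

/-- The subspace `W ⊆ ℂⁿ` is invariant under `v`, i.e. `v W ⊆ W ⊗ A`; tested by applying the
linear functionals on `A` to the entries of `v`. -/
def IsInvariant {n : Type*} [Fintype n] (v : Matrix n n A) (W : Submodule ℂ (n → ℂ)) : Prop :=
  ∀ φ : A →ₗ[ℂ] ℂ, ∀ x ∈ W, (v.map φ).mulVec x ∈ W

/-- Irreducible representation: nonzero, without nontrivial invariant subspaces. -/
def IsIrrep {n : Type*} [Fintype n] [DecidableEq n] (v : Matrix n n A) : Prop :=
  IsRep v ∧ Nonempty n ∧
    ∀ W : Submodule ℂ (n → ℂ), IsInvariant v W → W = ⊥ ∨ W = ⊤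

/-- Complete reducibility: each invariant subspace has an invariant complement. -/
def IsCompletelyReducible {n : Type*} [Fintype n] (v : Matrix n n A) : Prop :=
  ∀ W : Submodule ℂ (n → ℂ), IsInvariant v W →
    ∃ W' : Submodule ℂ (n → ℂ), IsInvariant v W' ∧ IsCompl W W'

/-- A complex matrix, seen as a matrix over a `ℂ`-algebra. -/
def scal (C : Type*) [Ring C] [Algebra ℂ C] {m n : Type*} (M : Matrix m n ℂ) : Matrix m n C :=
  M.map (algebraMap ℂ C)

/-- `M ∈ Mor(v, w)`, i.e. `M v = w M`. -/
def IsMor {m n : Type*} [Fintype m] [Fintype n] (v : Matrix m m A) (w : Matrix n n A)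
    (M : Matrix n m ℂ) : Prop :=
  scal A M * v = w * scal A M

/-- `a * ρ = (ρ ⊗ id) Δ a`. -/
def actR (ρ : A →ₗ[ℂ] ℂ) : A →ₗ[ℂ] A :=
  (TensorProduct.lid ℂ A).toLinearMap ∘ₗ LinearMap.rTensor A ρ ∘ₗ Coalgebra.comul

/-- `ρ * a = (id ⊗ ρ) Δ a`. -/
def actL (ρ : A →ₗ[ℂ] ℂ) : A →ₗ[ℂ] A :=
  (TensorProduct.rid ℂ A).toLinearMap ∘ₗ LinearMap.lTensor A ρ ∘ₗ Coalgebra.comul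

end Rep

/-! ### The homogeneous part -/

/-- The assumptions on the quantum group `H` with `Poly(H) = A` and on `Λ`: the coinverse of `A`
is invertible, each representation is completely reducible, `Λ` is irreducible, and
`Mor(v ⊗ w, Λ ⊗ v ⊗ w) = 0` for irreducible `v`, `w`. -/
structure HomogeneousData {A I : Type*} [Ring A] [HopfAlgebra ℂ A] [Fintype I] [DecidableEq I]
    (Λ : Matrix I I A) : Prop where
  antipode_bijective : Function.Bijective (HopfAlgebra.antipode ℂ : A →ₗ[ℂ] A)
  completelyReducible : ∀ (n : ℕ) (v : Matrix (Fin n) (Fin n) A), IsRep v →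
    IsCompletelyReducible v
  irreducible : IsIrrep Λ
  mor_eq_zero : ∀ (m n : ℕ) (v : Matrix (Fin m) (Fin m) A) (w : Matrix (Fin n) (Fin n) A),
    IsIrrep v → IsIrrep w → ∀ M : Matrix (I × (Fin m × Fin n)) (Fin m × Fin n) ℂ,
      IsMor (v ⊗ₖ w) (Λ ⊗ₖ (v ⊗ₖ w)) M → M = 0

/-! ### Inhomogeneous quantum groups -/

section Inhom

variable {A C I : Type*} [Ring A] [Ring C]

/-- The matrix `𝒫 = [[Λ, q], [0, 1]]` over `C`, where `Λ` is transported along `φ : A → C`. -/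
def Pmat [Bialgebra ℂ A] [Algebra ℂ C] (φ : A →ₐ[ℂ] C) (Λ : Matrix I I A) (q : I → C) :
    Matrix (I ⊕ Unit) (I ⊕ Unit) C :=
  Matrix.fromBlocks (Λ.map φ) (Matrix.of fun i _ => q i) 0 1

/-- `Γ = A · span{p_i} + A` inside `C`. -/
def Gam [Bialgebra ℂ A] [Algebra ℂ C] (φ : A →ₐ[ℂ] C) (p : I → C) : Submodule ℂ C :=
  Submodule.span ℂ (Set.range fun x : A × I => φ x.1 * p x.2) ⊔ LinearMap.range φ.toLinearMap

/-- The bialgebra `B` with the embedding `ι : A → B` and the elements `p_i` is an inhomogeneous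
quantum group built from `A` and `Λ`. -/
structure IsInhomogeneous {B : Type*} [Ring B] [Bialgebra ℂ A] [Bialgebra ℂ B]
    [Fintype I] [DecidableEq I] (Λ : Matrix I I A) (ι : A →ₐc[ℂ] B) (p : I → B) : Prop where
  generates : Algebra.adjoin ℂ (Set.range ι ∪ Set.range p) = ⊤
  injective : Function.Injective ι
  isRep : IsRep (Pmat (ι : A →ₐ[ℂ] B) Λ p)
  notMem : ∃ i, p i ∉ Set.range ι
  mul_mem : ∀ γ ∈ Gam (ι : A →ₐ[ℂ] B) p, ∀ a : A, γ * ι a ∈ Gam (ι : A →ₐ[ℂ] B) p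

end Inhom

/-! ### Matrices built from the functionals `f`, `η` and the numbers `T` -/

section Matrices

variable {A I n : Type*} [Ring A] [Bialgebra ℂ A]

/-- `(G_w)_{iC,Dj} = f_ij(w_CD)`. -/
def Gmat (f : I → I → A →ₗ[ℂ] ℂ) (w : Matrix n n A) : Matrix (I × n) (n × I) ℂ :=
  Matrix.of fun x y => f x.1 y.2 (w x.2 y.1)

/-- `(H_w)_{iC,D} = η_i(w_CD)`. -/
def Hmat (η : I → A →ₗ[ℂ] ℂ) (w : Matrix n n A) : Matrix (I × n) n ℂ :=
  Matrix.of fun x d => η x.1 (w x.2 d)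

/-- `N_w = [[G_w, H_w], [0, 1_w]]`, with rows indexed as in `𝒫 ⊗ w` and columns as in `w ⊗ 𝒫`. -/
def Nmat [DecidableEq n] (f : I → I → A →ₗ[ℂ] ℂ) (η : I → A →ₗ[ℂ] ℂ) (w : Matrix n n A) :
    Matrix ((I ⊕ Unit) × n) (n × (I ⊕ Unit)) ℂ :=
  Matrix.of fun x y => match x, y with
    | (Sum.inl i, c), (d, Sum.inl j) => Gmat f w (i, c) (d, j)
    | (Sum.inl i, c), (d, Sum.inr _) => Hmat η w (i, c) d
    | (Sum.inr _, _), (_, Sum.inl _) => 0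
    | (Sum.inr _, c), (d, Sum.inr _) => (1 : Matrix n n ℂ) c d

/-- `R = G_Λ`, i.e. `R_{ij,sm} = f_im(Λ_js)`. -/
def Rmat (f : I → I → A →ₗ[ℂ] ℂ) (Λ : Matrix I I A) : Matrix (I × I) (I × I) ℂ := Gmat f Λ

/-- `Z = H_Λ`, i.e. `Z_{ij,s} = η_i(Λ_js)`. -/
def Zmat (η : I → A →ₗ[ℂ] ℂ) (Λ : Matrix I I A) : Matrix (I × I) I ℂ := Hmat η Λ

variable [Fintype I] [DecidableEq I]

/-- The matrix `R_P`; the four blocks correspond to the index sets `I × I`, `I × {∗}`,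
`{∗} × I`, `{∗} × {∗}`, in this order:
```
  R   Z  -RZ  (R - 1)T
  0   0   1      0
  0   1   0      0
  0   0   0      1
```
-/
def RPmat (R : Matrix (I × I) (I × I) ℂ) (Z : Matrix (I × I) I ℂ) (T : I × I → ℂ) :
    Matrix ((I ⊕ Unit) × (I ⊕ Unit)) ((I ⊕ Unit) × (I ⊕ Unit)) ℂ :=
  Matrix.of fun x y => match x, y with
    | (Sum.inl k, Sum.inl l), (Sum.inl i, Sum.inl j) => R (k, l) (i, j)
    | (Sum.inl k, Sum.inl l), (Sum.inl i, Sum.inr _) => Z (k, l) i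
    | (Sum.inl k, Sum.inl l), (Sum.inr _, Sum.inl i) => -((R * Z) (k, l) i)
    | (Sum.inl k, Sum.inl l), (Sum.inr _, Sum.inr _) => (R - 1).mulVec T (k, l)
    | (Sum.inl k, Sum.inr _), (Sum.inr _, Sum.inl i) => (1 : Matrix I I ℂ) k i
    | (Sum.inr _, Sum.inl k), (Sum.inl i, Sum.inr _) => (1 : Matrix I I ℂ) k i
    | (Sum.inr _, Sum.inr _), (Sum.inr _, Sum.inr _) => 1
    | _, _ => 0

end Matrices

/-! ### Relations, formulated in an arbitrary algebra `C` under `A` with elements `q_i` -/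

section Relations

variable {A C I : Type*} [Ring A] [Bialgebra ℂ A] [Ring C] [Algebra ℂ C]
  [Fintype I] [DecidableEq I]

/-- `q_s a - ∑ₜ (a * f_st) q_t ∈ A` for all `a ∈ A`. In an inhomogeneous quantum group this
determines `f`. -/
def IsLeading (φ : A →ₐ[ℂ] C) (q : I → C) (f : I → I → A →ₗ[ℂ] ℂ) : Prop :=
  ∀ s a, q s * φ a - ∑ t, φ (actR (f s t) a) * q t ∈ Set.range φ

/-- `q_s a = (a * f_st) q_t + a * η_s - Λ_st (η_t * a)`, for all `a ∈ A`. -/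
def CrossRel (φ : A →ₐ[ℂ] C) (q : I → C) (Λ : Matrix I I A) (f : I → I → A →ₗ[ℂ] ℂ)
    (η : I → A →ₗ[ℂ] ℂ) : Prop :=
  ∀ s a, q s * φ a =
    ∑ t, φ (actR (f s t) a) * q t + φ (actR (η s) a) - ∑ t, φ (Λ s t * actL (η t) a)

/-- `(R - 1)_{kl,ij} (q_i q_j - η_i(Λ_js) q_s + T_ij - Λ_im Λ_jn T_mn) = 0`. -/
def QuadRel (φ : A →ₐ[ℂ] C) (q : I → C) (Λ : Matrix I I A) (f : I → I → A →ₗ[ℂ] ℂ)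
    (η : I → A →ₗ[ℂ] ℂ) (T : I × I → ℂ) : Prop :=
  ∀ k l, ∑ i, ∑ j, (Rmat f Λ - 1) (k, l) (i, j) •
    (q i * q j - ∑ s, η i (Λ j s) • q s + algebraMap ℂ C (T (i, j))
      - ∑ m, ∑ n, T (m, n) • φ (Λ i m * Λ j n)) = 0

/-- `(𝒫 ⊗ w) N_w = N_w (w ⊗ 𝒫)` for all representations `w` of `H`. -/
def PNRel (φ : A →ₐ[ℂ] C) (q : I → C) (Λ : Matrix I I A) (f : I → I → A →ₗ[ℂ] ℂ)
    (η : I → A →ₗ[ℂ] ℂ) : Prop :=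
  ∀ (n : ℕ) (w : Matrix (Fin n) (Fin n) A), IsRep w →
    (Pmat φ Λ q ⊗ₖ w.map φ) * scal C (Nmat f η w)
      = scal C (Nmat f η w) * (w.map φ ⊗ₖ Pmat φ Λ q)

/-- `R_P (𝒫 ⊗ 𝒫) = (𝒫 ⊗ 𝒫) R_P`. -/
def RPRel (φ : A →ₐ[ℂ] C) (q : I → C) (Λ : Matrix I I A) (f : I → I → A →ₗ[ℂ] ℂ)
    (η : I → A →ₗ[ℂ] ℂ) (T : I × I → ℂ) : Prop :=
  scal C (RPmat (Rmat f Λ) (Zmat η Λ) T) * (Pmat φ Λ q ⊗ₖ Pmat φ Λ q)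
    = (Pmat φ Λ q ⊗ₖ Pmat φ Λ q) * scal C (RPmat (Rmat f Λ) (Zmat η Λ) T)

end Relations

/-! ### Universal algebras with given relations -/

section Universal

/-- `B`, with `ι : A → B` and `p_i ∈ B`, is the universal unital algebra generated by `A` and the
`p_i` (with the units identified) subject to `CrossRel` and `QuadRel`. -/
def IsUniversalCrossQuad {A : Type u} {B : Type v} {I : Type x} [Ring A]
    [Bialgebra ℂ A] [Ring B] [Algebra ℂ B] [Fintype I] [DecidableEq I]
    (ι : A →ₐ[ℂ] B) (p : I → B) (Λ : Matrix I I A)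
    (f : I → I → A →ₗ[ℂ] ℂ) (η : I → A →ₗ[ℂ] ℂ) (T : I × I → ℂ) : Prop :=
  (CrossRel ι p Λ f η ∧ QuadRel ι p Λ f η T) ∧
    ∀ (C : Type w) [Ring C] [Algebra ℂ C] (φ : A →ₐ[ℂ] C) (q : I → C),
      CrossRel φ q Λ f η → QuadRel φ q Λ f η T →
        ∃! ψ : B →ₐ[ℂ] C, (∀ a, ψ (ι a) = φ a) ∧ ∀ i, ψ (p i) = q i

/-- The same for the relations `PNRel` and `RPRel`. -/
def IsUniversalRMatrix {A : Type u} {B : Type v} {I : Type x} [Ring A]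
    [Bialgebra ℂ A] [Ring B] [Algebra ℂ B] [Fintype I] [DecidableEq I]
    (ι : A →ₐ[ℂ] B) (p : I → B) (Λ : Matrix I I A)
    (f : I → I → A →ₗ[ℂ] ℂ) (η : I → A →ₗ[ℂ] ℂ) (T : I × I → ℂ) : Prop :=
  (PNRel ι p Λ f η ∧ RPRel ι p Λ f η T) ∧
    ∀ (C : Type w) [Ring C] [Algebra ℂ C] (φ : A →ₐ[ℂ] C) (q : I → C),
      PNRel φ q Λ f η → RPRel φ q Λ f η T →
        ∃! ψ : B →ₐ[ℂ] C, (∀ a, ψ (ι a) = φ a) ∧ ∀ i, ψ (p i) = q i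

end Universal

/-- `Λ_st (f_tr * a) = (a * f_st) Λ_tr` for all `a ∈ A`, and
`a ↦ [[f(a), η(a)], [0, ε(a)]]` is a unital homomorphism. -/
def IsStructureData {A I : Type*} [Ring A] [Bialgebra ℂ A] [Fintype I] [DecidableEq I]
    (Λ : Matrix I I A) (f : I → I → A →ₗ[ℂ] ℂ) (η : I → A →ₗ[ℂ] ℂ) : Prop :=
  (∀ s r a, ∑ t, Λ s t * actL (f t r) a = ∑ t, actR (f s t) a * Λ t r) ∧
    ∃ ρ : A →ₐ[ℂ] Matrix (I ⊕ Unit) (I ⊕ Unit) ℂ, ∀ a,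
      ρ a = Matrix.fromBlocks (Matrix.of fun i j => f i j a) (Matrix.of fun i _ => η i a)
        0 (Matrix.of fun _ _ => Coalgebra.counit (R := ℂ) a)

/-- `R² = 1`, and for all `x`: `x (R + 1) = 0` iff `B` has a relation
`∑ x_ij p_i p_j + ∑ b_i p_i + c = 0` with `b_i, c ∈ A`, i.e. iff `∑ x_ij p_i p_j ∈ Γ`
(as many quadratic relations as possible). -/
def IsMaximal {A B I : Type*} [Ring A] [Bialgebra ℂ A] [Ring B] [Algebra ℂ B]
    [Fintype I] [DecidableEq I] (ι : A →ₐ[ℂ] B) (p : I → B) (Λ : Matrix I I A)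
    (f : I → I → A →ₗ[ℂ] ℂ) : Prop :=
  Rmat f Λ * Rmat f Λ = 1 ∧
    ∀ x : I × I → ℂ, Matrix.vecMul x (Rmat f Λ + 1) = 0 ↔
      ∑ i, ∑ j, x (i, j) • (p i * p j) ∈ Gam ι p

end

end InhomQG

/-!
`B` carries a coaction of `A`, and irreducibility of `Λ` with `p ⊄ A` forces `Γ` to be free over `A`
on the `pᵢ` and `1`. So `p_s a = F_st(a) p_t + h_s(a)` has unique coefficients, and comparing
slices of the comultiplication gives `F_st(a) = a * f_st` and a cocycle identity for `h`. Averaging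
the cocycle against the Haar functional of `A` exhibits it as a coboundary, which is `η`; the
vanishing of `Mor(v ⊗ w, Λ ⊗ v ⊗ w)` makes `η` satisfy the product rule. Maximality puts
`(R - 1)(p_i p_j - η_i(Λ_js) p_s)` into `Γ`; being skew-primitive with respect to `Λ ⊗ Λ` it lies in
`A`, and the Haar functional produces `T`.

For universality, the relations allow one to rewrite the products of `n + 1` generators as
combinations of shorter products. Pairing with functionals shows that the relations among the
leading products are those forced by `R`, so that every relation of `B` already follows from (1)
and (2). Finally, the blocks of the matrix relations in b) are (1) and (2) themselves.
-/

namespace InhomQG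

noncomputable section

section Slices

variable {A B : Type*} [Ring A] [Bialgebra ℂ A] [Ring B] [Bialgebra ℂ B]

lemma eq_of_forall_dual {V : Type*} [AddCommGroup V] [Module ℂ V] {x y : V}
    (h : ∀ ρ : V →ₗ[ℂ] ℂ, ρ x = ρ y) : x = y :=
  sub_eq_zero.1 ((Module.forall_dual_apply_eq_zero_iff ℂ _).1 fun ρ => by
    rw [map_sub, h, sub_self])

lemma tensor_eq_of_slices {M N : Type*} [AddCommGroup M] [Module ℂ M] [AddCommGroup N]
    [Module ℂ N] {z z' : M ⊗[ℂ] N}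
    (h : ∀ ρ : N →ₗ[ℂ] ℂ, LinearMap.lTensor M ρ z = LinearMap.lTensor M ρ z') : z = z' := by
  classical
  let b := Module.Basis.ofVectorSpace ℂ N
  have coord_eq_slice (z : M ⊗[ℂ] N) (i) : TensorProduct.equivFinsuppOfBasisRight b z i =
      TensorProduct.rid ℂ M (LinearMap.lTensor M (b.coord i) z) := by
    induction z with
    | zero => simp
    | tmul => simp
    | add x y hx hy => simp only [map_add, Finsupp.add_apply, hx, hy]
  refine (TensorProduct.equivFinsuppOfBasisRight b).injective (Finsupp.ext fun i => ?_)
  rw [coord_eq_slice, coord_eq_slice, h]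

lemma linearMap_apply_eq_sum {n M : Type*} [Fintype n] [DecidableEq n] [AddCommGroup M] [Module ℂ M]
    (E : (n → ℂ) →ₗ[ℂ] M) (x : n → ℂ) : E x = ∑ c, x c • E (Pi.single c 1) := by
  conv_lhs => rw [← (Pi.basisFun ℂ n).sum_repr x]
  simp

lemma exists_comul_eq (x : A) : ∃ (n : ℕ) (b c : Fin n → A),
    Coalgebra.comul (R := ℂ) x = ∑ k, b k ⊗ₜ[ℂ] c k :=
  TensorProduct.exists_sum_tmul_eq _

lemma actL_of_comul {κ : Type*} [Fintype κ] (ρ : A →ₗ[ℂ] ℂ) {y : A} {b c : κ → A}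
    (hy : Coalgebra.comul (R := ℂ) y = ∑ k, b k ⊗ₜ[ℂ] c k) :
    actL ρ y = ∑ k, ρ (c k) • b k := by
  simp [actL, hy]

lemma actR_of_comul {κ : Type*} [Fintype κ] (ρ : A →ₗ[ℂ] ℂ) {y : A} {b c : κ → A}
    (hy : Coalgebra.comul (R := ℂ) y = ∑ k, b k ⊗ₜ[ℂ] c k) :
    actR ρ y = ∑ k, ρ (b k) • c k := by
  simp [actR, hy]

lemma comul_eq_of_actL {κ : Type*} [Fintype κ] {y : A} {b c : κ → A}
    (h : ∀ ρ : A →ₗ[ℂ] ℂ, actL ρ y = ∑ k, ρ (c k) • b k) :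
    Coalgebra.comul (R := ℂ) y = ∑ k, b k ⊗ₜ[ℂ] c k := by
  refine tensor_eq_of_slices fun ρ => (TensorProduct.rid ℂ A).injective ?_
  refine (h ρ).trans ?_
  simp

lemma dual_actL (f ρ : A →ₗ[ℂ] ℂ) (x : A) : f (actL ρ x) = ρ (actR f x) := by
  obtain ⟨n, b, c, h⟩ := exists_comul_eq x
  simp [actL_of_comul ρ h, actR_of_comul f h, mul_comm]

@[simp] lemma actL_counit (x : A) : actL (Coalgebra.counit (R := ℂ)) x = x := by
  simp [actL]

@[simp] lemma actR_counit (x : A) : actR (Coalgebra.counit (R := ℂ)) x = x := by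
  simp [actR]

@[simp] lemma counit_actL (ρ : A →ₗ[ℂ] ℂ) (x : A) :
    Coalgebra.counit (R := ℂ) (actL ρ x) = ρ x := by
  rw [dual_actL, actR_counit]

@[simp] lemma counit_actR (ρ : A →ₗ[ℂ] ℂ) (x : A) :
    Coalgebra.counit (R := ℂ) (actR ρ x) = ρ x := by
  rw [← dual_actL, actL_counit]

@[simp] lemma actL_one (ρ : A →ₗ[ℂ] ℂ) : actL ρ (1 : A) = ρ 1 • (1 : A) := by
  simp [actL, Algebra.TensorProduct.one_def]

@[simp] lemma actL_smul (z : ℂ) (ρ : A →ₗ[ℂ] ℂ) (x : A) : actL (z • ρ) x = z • actL ρ x := by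
  simp [actL]

@[simp] lemma actL_zero (x : A) : actL (0 : A →ₗ[ℂ] ℂ) x = 0 := by
  simp [actL]

lemma actL_map (F : A →ₗc[ℂ] B) (ρ : B →ₗ[ℂ] ℂ) (a : A) :
    actL ρ (F a) = F (actL (ρ ∘ₗ (F : A →ₗ[ℂ] B)) a) := by
  obtain ⟨n, b, c, h⟩ := exists_comul_eq a
  have h_map : Coalgebra.comul (R := ℂ) (F a) = ∑ k, F (b k) ⊗ₜ[ℂ] F (c k) := by
    rw [← CoalgHomClass.map_comp_comul_apply, h]
    simp
  simp [actL_of_comul _ h, actL_of_comul _ h_map]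

lemma actR_map (F : A →ₗc[ℂ] B) (ρ : B →ₗ[ℂ] ℂ) (a : A) :
    actR ρ (F a) = F (actR (ρ ∘ₗ (F : A →ₗ[ℂ] B)) a) :=
  eq_of_forall_dual fun σ => by
    rw [← dual_actL, actL_map]
    exact dual_actL (ρ ∘ₗ (F : A →ₗ[ℂ] B)) (σ ∘ₗ (F : A →ₗ[ℂ] B)) a

lemma actL_mul_right {κ : Type*} [Fintype κ] (ρ : A →ₗ[ℂ] ℂ) (x : A) {y : A} {b c : κ → A}
    (hy : Coalgebra.comul (R := ℂ) y = ∑ k, b k ⊗ₜ[ℂ] c k) :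
    actL ρ (x * y) = ∑ k, actL (ρ ∘ₗ LinearMap.mulRight ℂ (c k)) x * b k := by
  obtain ⟨n, b', c', h⟩ := exists_comul_eq x
  have h_mul : Coalgebra.comul (R := ℂ) (x * y)
      = ∑ z : Fin n × κ, (b' z.1 * b z.2) ⊗ₜ[ℂ] (c' z.1 * c z.2) := by
    simp [Bialgebra.comul_mul, h, hy, Finset.sum_mul_sum, Fintype.sum_prod_type]
  simp [actL_of_comul _ h_mul, actL_of_comul _ h, Fintype.sum_prod_type_right, Finset.sum_mul]

lemma actL_mul_left {κ : Type*} [Fintype κ] (ρ : A →ₗ[ℂ] ℂ) (x : A) {y : A} {b c : κ → A}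
    (hy : Coalgebra.comul (R := ℂ) y = ∑ k, b k ⊗ₜ[ℂ] c k) :
    actL ρ (y * x) = ∑ k, b k * actL (ρ ∘ₗ LinearMap.mulLeft ℂ (c k)) x := by
  obtain ⟨n, b', c', h⟩ := exists_comul_eq x
  have h_mul : Coalgebra.comul (R := ℂ) (y * x)
      = ∑ z : κ × Fin n, (b z.1 * b' z.2) ⊗ₜ[ℂ] (c z.1 * c' z.2) := by
    simp [Bialgebra.comul_mul, h, hy, Finset.sum_mul_sum, Fintype.sum_prod_type]
  simp [actL_of_comul _ h_mul, actL_of_comul _ h, Fintype.sum_prod_type, Finset.mul_sum]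

lemma actL_actR (ρ f : A →ₗ[ℂ] ℂ) (x : A) : actL ρ (actR f x) = actR f (actL ρ x) := by
  let Φ : A ⊗[ℂ] (A ⊗[ℂ] A) →ₗ[ℂ] A := (TensorProduct.lid ℂ A).toLinearMap ∘ₗ
    TensorProduct.map f ((TensorProduct.rid ℂ A).toLinearMap ∘ₗ LinearMap.lTensor A ρ)
  have slice_right (z : A ⊗[ℂ] A) : Φ (LinearMap.lTensor A Coalgebra.comul z)
      = actL ρ ((TensorProduct.lid ℂ A) (LinearMap.rTensor A f z)) := by
    induction z with
    | zero => simp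
    | tmul a b => simp [Φ, actL]
    | add a b ha hb => simp only [map_add, ha, hb]
  have slice_left (z : A ⊗[ℂ] A) :
      Φ (TensorProduct.assoc ℂ A A A (LinearMap.rTensor A Coalgebra.comul z))
        = actR f ((TensorProduct.rid ℂ A) (LinearMap.lTensor A ρ z)) := by
    induction z with
    | zero => simp
    | tmul a b =>
      obtain ⟨n, b', c', h⟩ := exists_comul_eq a
      simp [Φ, actR, h, TensorProduct.sum_tmul, Finset.smul_sum, smul_smul]
    | add a b ha hb => simp only [map_add, ha, hb]
  exact ((slice_left _).symm.trans
    ((congrArg Φ (Coalgebra.coassoc_apply (R := ℂ) x)).trans (slice_right _))).symm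

lemma actL_actL (σ ρ : A →ₗ[ℂ] ℂ) (x : A) : actL σ (actL ρ x) = actL (ρ ∘ₗ actR σ) x := by
  refine eq_of_forall_dual fun f => ?_
  rw [dual_actL, ← actL_actR, dual_actL, dual_actL, LinearMap.comp_apply]

lemma IsRep.actL {n : Type*} [Fintype n] [DecidableEq n] {w : Matrix n n A} (hw : IsRep w)
    (ρ : A →ₗ[ℂ] ℂ) (c d : n) : actL ρ (w c d) = ∑ e, ρ (w e d) • w c e :=
  actL_of_comul ρ (hw.1 c d)

lemma IsRep.actR {n : Type*} [Fintype n] [DecidableEq n] {w : Matrix n n A} (hw : IsRep w)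
    (ρ : A →ₗ[ℂ] ℂ) (c d : n) : actR ρ (w c d) = ∑ e, ρ (w c e) • w e d :=
  actR_of_comul ρ (hw.1 c d)

end Slices

section Comodules

variable (A : Type*) [Ring A] [Bialgebra ℂ A]

/-- The dual of `A` with the convolution product. It acts on `A` by `ρ • a = ρ * a`; its submodules
in `A` are the right subcomodules of `A`, so that Mathlib's theory of semisimple modules applies to
them. -/
abbrev ConvDual : Type _ := WithConv (A →ₗ[ℂ] ℂ)

variable {A}

instance : Module (ConvDual A) A where
  smul ρ := actL ρ.ofConv
  one_smul := actL_counit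
  mul_smul σ ρ x := by
    refine Eq.trans ?_ (actL_actL σ.ofConv ρ.ofConv x).symm
    change actL (σ * ρ).ofConv x = _
    congr 2
    ext a
    obtain ⟨n, b, c, h⟩ := exists_comul_eq a
    simp [LinearMap.convMul_def, actR_of_comul _ h, h]
  smul_zero ρ := map_zero (actL ρ.ofConv)
  smul_add ρ := map_add (actL ρ.ofConv)
  add_smul σ ρ x := by
    obtain ⟨n, b, c, h⟩ := exists_comul_eq x
    change actL (σ.ofConv + ρ.ofConv) x = actL σ.ofConv x + actL ρ.ofConv x
    simp [actL_of_comul _ h, add_smul, Finset.sum_add_distrib]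
  zero_smul := actL_zero

instance : IsScalarTower ℂ (ConvDual A) A :=
  ⟨fun z ρ x => actL_smul z ρ.ofConv x⟩

lemma actL_mem_submodule (W : Submodule (ConvDual A) A) (ρ : A →ₗ[ℂ] ℂ) {x : A}
    (hx : x ∈ W) : actL ρ x ∈ W :=
  W.smul_mem (WithConv.toConv ρ) hx

/-- A subspace stable under all `a ↦ ρ * a`, as a submodule over the convolution algebra. -/
def stableSubmodule (W : Submodule ℂ A) (hW : ∀ ρ, ∀ x ∈ W, actL ρ x ∈ W) :
    Submodule (ConvDual A) A where
  toAddSubmonoid := W.toAddSubmonoid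
  smul_mem' ρ x := hW ρ.ofConv x

lemma exists_finite_stable (x : A) : ∃ W : Submodule (ConvDual A) A, x ∈ W ∧
    FiniteDimensional ℂ (W.restrictScalars ℂ) := by
  let V : Submodule ℂ A := Submodule.span ℂ (Set.range fun ρ : A →ₗ[ℂ] ℂ => actL ρ x)
  have actL_mem (ρ) (y) (hy : y ∈ V) : actL ρ y ∈ V := by
    refine (Submodule.span_le (p := V.comap (actL ρ))).2 ?_ hy
    rintro _ ⟨σ, rfl⟩
    exact Submodule.subset_span ⟨_, (actL_actL ρ σ x).symm⟩
  obtain ⟨n, b, c, h⟩ := exists_comul_eq x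
  have le_span : V ≤ Submodule.span ℂ (Set.range b) := by
    refine Submodule.span_le.2 ?_
    rintro _ ⟨ρ, rfl⟩
    simp only [actL_of_comul ρ h, SetLike.mem_coe]
    exact Submodule.sum_mem _ fun k _ => Submodule.smul_mem _ _ (Submodule.subset_span ⟨k, rfl⟩)
  have := FiniteDimensional.span_of_finite ℂ (Set.finite_range b)
  exact ⟨stableSubmodule V actL_mem, Submodule.subset_span ⟨Coalgebra.counit, actL_counit x⟩,
    Submodule.finiteDimensional_of_le le_span⟩

/-- The linear map `E : ℂⁿ → A` intertwines the representation `w` with the comultiplication of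
`A`, i.e. it is a homomorphism of right comodules. -/
def IsComoduleMap {n : Type*} [Fintype n] (w : Matrix n n A) (E : (n → ℂ) →ₗ[ℂ] A) : Prop :=
  ∀ (ρ : A →ₗ[ℂ] ℂ) x, actL ρ (E x) = E ((w.map ρ).mulVec x)

lemma exists_rep_of_finite (V : Submodule (ConvDual A) A)
    [FiniteDimensional ℂ (V.restrictScalars ℂ)] :
    ∃ (n : ℕ) (w : Matrix (Fin n) (Fin n) A) (E : (Fin n → ℂ) →ₗ[ℂ] A), IsRep w ∧
      IsComoduleMap w E ∧ Function.Injective E ∧ E.range = V.restrictScalars ℂ := by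
  let e := Module.finBasis ℂ (V.restrictScalars ℂ)
  choose g hg using fun c => LinearMap.exists_extend (e.coord c)
  have g_apply (c) (x : V.restrictScalars ℂ) : g c x = e.repr x c := LinearMap.congr_fun (hg c) x
  let w : Matrix (Fin _) (Fin _) A := Matrix.of fun c d => actR (g c) (e d : A)
  have actL_basis (ρ : A →ₗ[ℂ] ℂ) (d) : actL ρ (e d : A) = ∑ c, ρ (w c d) • (e c : A) := by
    have h_sum := congrArg Subtype.val
      (e.sum_repr ⟨actL ρ (e d : A), actL_mem_submodule V ρ (e d).2⟩)
    simp only [Submodule.coe_sum, Submodule.coe_smul, ← g_apply] at h_sum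
    rw [← h_sum]
    exact Finset.sum_congr rfl fun c _ => by rw [dual_actL]; rfl
  refine ⟨_, w, (V.restrictScalars ℂ).subtype ∘ₗ e.equivFun.symm.toLinearMap,
    ⟨fun c d => comul_eq_of_actL fun ρ => ?_, fun c d => ?_⟩, fun ρ x => ?_,
    (V.restrictScalars ℂ).injective_subtype.comp e.equivFun.symm.injective, ?_⟩
  · simp only [w, Matrix.of_apply]
    rw [actL_actR, actL_basis, map_sum]
    simp [w]
  · simp only [w, Matrix.of_apply, counit_actR, g_apply]
    simp [Matrix.one_apply, Finsupp.single_apply, eq_comm]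
  · simp only [LinearMap.comp_apply, LinearEquiv.coe_coe, Submodule.subtype_apply,
      Module.Basis.equivFun_symm_apply, map_sum, map_smul, actL_basis, Matrix.mulVec, dotProduct,
      Matrix.map_apply, Finset.sum_smul, Finset.smul_sum, smul_smul]
    rw [Finset.sum_comm]
    simp only [mul_comm]
  · rw [LinearMap.range_comp, LinearEquiv.range, Submodule.map_top, Submodule.range_subtype]

namespace IsComoduleMap

variable {n : Type*} [Fintype n] {w : Matrix n n A} {E : (n → ℂ) →ₗ[ℂ] A}

lemma isInvariant_comap (hE : IsComoduleMap w E) (U : Submodule (ConvDual A) A) :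
    IsInvariant w ((U.restrictScalars ℂ).comap E) := fun ρ x hx => by
  rw [Submodule.mem_comap, ← hE]
  exact actL_mem_submodule U ρ hx

/-- The image of an invariant subspace under a homomorphism of comodules. -/
def mapInvariant (hE : IsComoduleMap w E) {W : Submodule ℂ (n → ℂ)} (hW : IsInvariant w W) :
    Submodule (ConvDual A) A :=
  stableSubmodule (W.map E) <| by
    rintro ρ _ ⟨x, hx, rfl⟩
    exact ⟨_, hW ρ x hx, (hE ρ x).symm⟩

lemma restrictScalars_mapInvariant (hE : IsComoduleMap w E) {W : Submodule ℂ (n → ℂ)}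
    (hW : IsInvariant w W) : (hE.mapInvariant hW).restrictScalars ℂ = W.map E := rfl

lemma apply_single_eq [DecidableEq n] (hE : IsComoduleMap w E) (d : n) :
    E (Pi.single d 1) = ∑ c, Coalgebra.counit (R := ℂ) (E (Pi.single c 1)) • w c d := by
  refine eq_of_forall_dual fun ρ => ?_
  rw [← counit_actL ρ (E _), hE, linearMap_apply_eq_sum E]
  simp [mul_comm]

lemma isIrrep [DecidableEq n] (hE : IsComoduleMap w E) (hw : IsRep w)
    (hinj : Function.Injective E) {V : Submodule (ConvDual A) A}
    (hV : IsSimpleModule (ConvDual A) V) (hrange : E.range = V.restrictScalars ℂ) :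
    IsIrrep w := by
  have hatom := isSimpleModule_iff_isAtom.1 hV
  refine ⟨hw, ?_, fun W hW => ?_⟩
  · by_contra hn
    rw [not_nonempty_iff] at hn
    refine hatom.1 (Submodule.restrictScalars_injective ℂ _ _ (hrange.symm.trans ?_))
    exact LinearMap.range_eq_bot.2 (Subsingleton.elim _ _)
  · have hle : hE.mapInvariant hW ≤ V := by
      rw [← Submodule.restrictScalars_le (S := ℂ), ← hrange, restrictScalars_mapInvariant]
      exact LinearMap.map_le_range
    refine (hatom.le_iff.1 hle).imp (fun h => ?_) fun h => ?_
    all_goals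
      refine Submodule.map_injective_of_injective hinj ?_
      rw [← restrictScalars_mapInvariant hE hW, h]
    · exact (Submodule.map_bot E).symm
    · rw [Submodule.map_top, hrange]

end IsComoduleMap

lemma isSemisimpleModule_of_finite
    (hcr : ∀ (n : ℕ) (v : Matrix (Fin n) (Fin n) A), IsRep v → IsCompletelyReducible v)
    (V : Submodule (ConvDual A) A) [FiniteDimensional ℂ (V.restrictScalars ℂ)] :
    IsSemisimpleModule (ConvDual A) V := by
  obtain ⟨n, w, E, hw, hE, hinj, hrange⟩ := exists_rep_of_finite V
  rw [isSemisimpleModule_iff, V.mapIic.complementedLattice_iff]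
  refine Set.Iic.complementedLattice_iff.2 fun U hU => ?_
  obtain ⟨W, hW, hdisj, hsup⟩ := hcr n w hw _ (hE.isInvariant_comap U)
  have map_comap : ((U.restrictScalars ℂ).comap E).map E = U.restrictScalars ℂ := by
    rw [Submodule.map_comap_eq, hrange]
    exact inf_eq_right.2 hU
  have hdisj' := (Submodule.disjoint_map hinj hdisj).eq_bot
  have hsup' := congrArg (Submodule.map E) hsup.eq_top
  rw [map_comap, ← hE.restrictScalars_mapInvariant hW] at hdisj'
  rw [Submodule.map_sup, map_comap, Submodule.map_top, hrange,
    ← hE.restrictScalars_mapInvariant hW, ← Submodule.restrictScalars_sup] at hsup'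
  have hsup'' := Submodule.restrictScalars_injective ℂ _ _ hsup'
  exact ⟨hE.mapInvariant hW, le_sup_right.trans_eq hsup'',
    Submodule.restrictScalars_injective ℂ _ _ hdisj', hsup''⟩

lemma isSemisimpleModule_convDual
    (hcr : ∀ (n : ℕ) (v : Matrix (Fin n) (Fin n) A), IsRep v → IsCompletelyReducible v) :
    IsSemisimpleModule (ConvDual A) A := by
  choose V hV hfin using exists_finite_stable (A := A)
  exact isSemisimpleModule_of_isSemisimpleModule_submodule' (p := V)
    (fun x => isSemisimpleModule_of_finite hcr (V x))
    (eq_top_iff.2 fun x _ => Submodule.mem_iSup_of_mem x (hV x))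

lemma finiteDimensional_of_isSimpleModule {V : Submodule (ConvDual A) A}
    (hV : IsSimpleModule (ConvDual A) V) : FiniteDimensional ℂ (V.restrictScalars ℂ) := by
  have hatom := isSimpleModule_iff_isAtom.1 hV
  obtain ⟨y, hy, hy0⟩ := (Submodule.ne_bot_iff V).1 hatom.1
  obtain ⟨W, hyW, hW⟩ := exists_finite_stable y
  have hle : V ≤ W := by
    rcases hatom.le_iff.1 (inf_le_left : V ⊓ W ≤ V) with h | h
    · exact absurd ((Submodule.eq_bot_iff _).1 h y ⟨hy, hyW⟩) hy0
    · exact inf_eq_left.1 h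
  exact Submodule.finiteDimensional_of_le (S₂ := W.restrictScalars ℂ) hle

lemma mem_span_irrep_of_isSimpleModule {V : Submodule (ConvDual A) A}
    (hV : IsSimpleModule (ConvDual A) V) {x : A} (hx : x ∈ V) :
    x ∈ Submodule.span ℂ {a : A | ∃ (n : ℕ) (w : Matrix (Fin n) (Fin n) A), IsIrrep w ∧
      ∃ c d, w c d = a} := by
  have := finiteDimensional_of_isSimpleModule hV
  obtain ⟨n, w, E, hw, hE, hinj, hrange⟩ := exists_rep_of_finite V
  obtain ⟨z, rfl⟩ : x ∈ E.range := hrange ▸ hx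
  rw [linearMap_apply_eq_sum]
  refine Submodule.sum_mem _ fun d _ => Submodule.smul_mem _ _ ?_
  rw [hE.apply_single_eq]
  exact Submodule.sum_mem _ fun c _ => Submodule.smul_mem _ _
    (Submodule.subset_span ⟨n, w, hE.isIrrep hw hinj hV hrange, c, d, rfl⟩)

lemma span_irrep_eq_top
    (hcr : ∀ (n : ℕ) (v : Matrix (Fin n) (Fin n) A), IsRep v → IsCompletelyReducible v) :
    Submodule.span ℂ {a : A | ∃ (n : ℕ) (w : Matrix (Fin n) (Fin n) A), IsIrrep w ∧
      ∃ c d, w c d = a} = ⊤ := by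
  have := isSemisimpleModule_convDual hcr
  refine eq_top_iff.2 fun x _ => ?_
  have hx : x ∈ sSup {m : Submodule (ConvDual A) A | IsSimpleModule (ConvDual A) m} := by
    rw [IsSemisimpleModule.sSup_simples_eq_top]
    trivial
  rw [sSup_eq_iSup'] at hx
  induction hx using Submodule.iSup_induction' with
  | mem V y hy => exact mem_span_irrep_of_isSimpleModule V.2 hy
  | zero => exact Submodule.zero_mem _
  | add y z _ _ hy hz => exact Submodule.add_mem _ (hy trivial) (hz trivial)

lemma linearMap_ext_irrep
    (hcr : ∀ (n : ℕ) (v : Matrix (Fin n) (Fin n) A), IsRep v → IsCompletelyReducible v)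
    {M : Type*} [AddCommGroup M] [Module ℂ M] {f g : A →ₗ[ℂ] M}
    (h : ∀ (n : ℕ) (w : Matrix (Fin n) (Fin n) A), IsIrrep w → ∀ c d, f (w c d) = g (w c d)) :
    f = g := by
  refine LinearMap.ext_on (span_irrep_eq_top hcr) ?_
  rintro _ ⟨n, w, hw, c, d, rfl⟩
  exact h n w hw c d

end Comodules

section Antipode

variable {A : Type*} [Ring A] [HopfAlgebra ℂ A] {n : Type*} [Fintype n] [DecidableEq n]
  {w : Matrix n n A}

lemma IsRep.map_antipode_mul (hw : IsRep w) : w.map (HopfAlgebra.antipode ℂ) * w = 1 := by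
  ext c d
  have h := HopfAlgebra.mul_antipode_rTensor_comul_apply (R := ℂ) (w c d)
  rw [hw.1, hw.2] at h
  simpa [Matrix.mul_apply, Matrix.one_apply, apply_ite] using h

lemma IsRep.mul_map_antipode (hw : IsRep w) : w * w.map (HopfAlgebra.antipode ℂ) = 1 := by
  ext c d
  have h := HopfAlgebra.mul_antipode_lTensor_comul_apply (R := ℂ) (w c d)
  rw [hw.1, hw.2] at h
  simpa [Matrix.mul_apply, Matrix.one_apply, apply_ite] using h

/-- The entrywise embedding `a ↦ a ⊗ 1`. -/
abbrev legOne : Matrix n n A →ₐ[ℂ] Matrix n n (A ⊗[ℂ] A) :=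
  (Algebra.TensorProduct.includeLeft : A →ₐ[ℂ] A ⊗[ℂ] A).mapMatrix

/-- The entrywise embedding `a ↦ 1 ⊗ a`. -/
abbrev legTwo : Matrix n n A →ₐ[ℂ] Matrix n n (A ⊗[ℂ] A) :=
  (Algebra.TensorProduct.includeRight : A →ₐ[ℂ] A ⊗[ℂ] A).mapMatrix

/-- The entrywise comultiplication. -/
abbrev comulMatrix : Matrix n n A →ₐ[ℂ] Matrix n n (A ⊗[ℂ] A) :=
  (Bialgebra.comulAlgHom ℂ A).mapMatrix

lemma IsRep.comulMatrix_eq (hw : IsRep w) : comulMatrix w = legOne w * legTwo w := by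
  ext c d
  simp [hw.1, Matrix.mul_apply]

lemma IsRep.comulMatrix_antipode (hw : IsRep w) :
    comulMatrix (w.map (HopfAlgebra.antipode ℂ)) =
      legTwo (w.map (HopfAlgebra.antipode ℂ)) * legOne (w.map (HopfAlgebra.antipode ℂ)) := by
  refine left_inv_eq_right_inv (a := comulMatrix w) ?_ ?_
  · rw [← map_mul, hw.map_antipode_mul, map_one]
  · rw [hw.comulMatrix_eq, mul_assoc, ← mul_assoc (legTwo w), ← map_mul legTwo,
      hw.mul_map_antipode, map_one, one_mul, ← map_mul, hw.mul_map_antipode, map_one]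

lemma IsRep.comul_antipode (hw : IsRep w) (c d : n) :
    Coalgebra.comul (R := ℂ) (HopfAlgebra.antipode ℂ (w c d)) =
      ∑ e, HopfAlgebra.antipode ℂ (w e d) ⊗ₜ[ℂ] HopfAlgebra.antipode ℂ (w c e) := by
  have h := congrArg (fun X : Matrix n n (A ⊗[ℂ] A) => X c d) hw.comulMatrix_antipode
  simpa [Matrix.mul_apply] using h

end Antipode

section Haar

variable {A : Type*} [Ring A]

lemma exists_projection [Bialgebra ℂ A]
    (hcr : ∀ (n : ℕ) (v : Matrix (Fin n) (Fin n) A), IsRep v → IsCompletelyReducible v)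
    (U : Submodule (ConvDual A) A) : ∃ P : A →ₗ[ConvDual A] U, ∀ x : U, P x = x := by
  have := isSemisimpleModule_convDual hcr
  obtain ⟨P, hP⟩ := IsSemisimpleModule.extension_property (R := ConvDual A) (N := U) (M := A)
    U.subtype U.injective_subtype LinearMap.id
  exact ⟨P, LinearMap.congr_fun hP⟩

lemma exists_left_haar [Bialgebra ℂ A]
    (hcr : ∀ (n : ℕ) (v : Matrix (Fin n) (Fin n) A), IsRep v → IsCompletelyReducible v) :
    ∃ χ : A →ₗ[ℂ] ℂ, χ 1 = 1 ∧ ∀ a, actR χ a = χ a • (1 : A) := by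
  have actL_mem (ρ : A →ₗ[ℂ] ℂ) (x : A) (hx : x ∈ Submodule.span ℂ {1}) :
      actL ρ x ∈ Submodule.span ℂ {1} := by
    obtain ⟨z, rfl⟩ := Submodule.mem_span_singleton.1 hx
    rw [map_smul, actL_one, smul_smul]
    exact Submodule.smul_mem _ _ (Submodule.mem_span_singleton_self _)
  let U : Submodule (ConvDual A) A := stableSubmodule (Submodule.span ℂ {1}) actL_mem
  obtain ⟨P, hP⟩ := exists_projection hcr U
  let χ : A →ₗ[ℂ] ℂ := Coalgebra.counit (R := ℂ) (A := A) ∘ₗ (U.subtype ∘ₗ P).restrictScalars ℂ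
  have P_eq (a : A) : (P a : A) = χ a • (1 : A) := by
    obtain ⟨z, hz⟩ := Submodule.mem_span_singleton.1 (show (P a : A) ∈ Submodule.span ℂ {1} from
      (P a).2)
    simp [χ, ← hz]
  have P_one : (P 1 : A) = 1 :=
    congrArg Subtype.val (hP ⟨1, Submodule.mem_span_singleton_self _⟩)
  have P_actL (ρ : A →ₗ[ℂ] ℂ) (a : A) : (P (actL ρ a) : A) = actL ρ (P a : A) :=
    congrArg Subtype.val (P.map_smul (WithConv.toConv ρ) a)
  refine ⟨χ, by simp [χ, P_one], fun a => eq_of_forall_dual fun ρ => ?_⟩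
  rw [← dual_actL, ← P_eq]
  simp [χ, P_actL]

lemma exists_haar [HopfAlgebra ℂ A]
    (hS : Function.Injective (HopfAlgebra.antipode ℂ : A →ₗ[ℂ] A))
    (hcr : ∀ (n : ℕ) (v : Matrix (Fin n) (Fin n) A), IsRep v → IsCompletelyReducible v) :
    ∃ χ : A →ₗ[ℂ] ℂ, χ 1 = 1 ∧ ∀ a, actL χ a = χ a • (1 : A) := by
  obtain ⟨χ, χ_one, actR_χ⟩ := exists_left_haar hcr
  let S : A →ₗ[ℂ] A := HopfAlgebra.antipode ℂ
  have S_actL : S ∘ₗ actL (χ ∘ₗ S) = actR χ ∘ₗ S := by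
    refine linearMap_ext_irrep hcr fun n w hw c d => ?_
    simp [hw.1.actL, actR_of_comul χ (hw.1.comul_antipode c d), S]
  refine ⟨χ ∘ₗ S, by simp [S, χ_one], fun a => hS ((LinearMap.congr_fun S_actL a).trans ?_)⟩
  simp [actR_χ, S]

end Haar

section Freeness

variable {A B C I : Type*} [Ring A] [Ring B] [Ring C] [Fintype I]

/-- The map `(a, b) ↦ ∑ aᵢ pᵢ + b`, which parametrizes `Γ`. -/
def gamMap [Bialgebra ℂ A] [Algebra ℂ C] (φ : A →ₐ[ℂ] C) (p : I → C) : (I → A) × A →ₗ[ℂ] C :=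
  (∑ i, LinearMap.mulRight ℂ (p i) ∘ₗ φ.toLinearMap ∘ₗ LinearMap.proj i).coprod φ.toLinearMap

@[simp] lemma gamMap_apply [Bialgebra ℂ A] [Algebra ℂ C] (φ : A →ₐ[ℂ] C) (p : I → C)
    (x : (I → A) × A) : gamMap φ p x = ∑ i, φ (x.1 i) * p i + φ x.2 := by
  simp [gamMap]

lemma gamMap_single [DecidableEq I] [Bialgebra ℂ A] [Algebra ℂ C] (φ : A →ₐ[ℂ] C) (p : I → C)
    (i : I) (a : A) : gamMap φ p (Pi.single i a, 0) = φ a * p i := by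
  rw [gamMap_apply, Finset.sum_eq_single i (fun j _ hj => by simp [hj]) (by simp)]
  simp

lemma range_gamMap [Bialgebra ℂ A] [Algebra ℂ C] (φ : A →ₐ[ℂ] C) (p : I → C) :
    LinearMap.range (gamMap φ p) = Gam φ p := by
  classical
  refine le_antisymm ?_ (sup_le (Submodule.span_le.2 ?_) ?_)
  · rintro _ ⟨⟨a, b⟩, rfl⟩
    rw [gamMap_apply]
    exact Submodule.add_mem _
      (Submodule.sum_mem _ fun i _ =>
        Submodule.mem_sup_left (Submodule.subset_span ⟨(a i, i), rfl⟩))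
      (Submodule.mem_sup_right ⟨b, rfl⟩)
  · rintro _ ⟨⟨a, i⟩, rfl⟩
    exact ⟨_, gamMap_single φ p i a⟩
  · rintro _ ⟨b, rfl⟩
    exact ⟨(0, b), by simp⟩

lemma exists_extend_dual [Bialgebra ℂ A] [Bialgebra ℂ B] {ι : A →ₐc[ℂ] B}
    (hι : Function.Injective ι) (φ : A →ₗ[ℂ] ℂ) :
    ∃ ρ : B →ₗ[ℂ] ℂ, ρ ∘ₗ (ι : A →ₗ[ℂ] B) = φ := by
  obtain ⟨r, hr⟩ := LinearMap.exists_leftInverse_of_injective (ι : A →ₗ[ℂ] B)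
    (LinearMap.ker_eq_bot.2 hι)
  exact ⟨φ ∘ₗ r, by rw [LinearMap.comp_assoc, hr, LinearMap.comp_id]⟩

lemma exists_comul_eq_sum_actL {κ : Type*} [Finite κ] [Bialgebra ℂ A] (x : κ → A) :
    ∃ (n : ℕ) (ρ : Fin n → A →ₗ[ℂ] ℂ) (c : Fin n → A),
      ∀ i, Coalgebra.comul (R := ℂ) (x i) = ∑ k, actL (ρ k) (x i) ⊗ₜ[ℂ] c k := by
  choose n b c h using fun i => exists_comul_eq (x i)
  let V : Submodule ℂ A := Submodule.span ℂ (Set.range fun k : Σ i, Fin (n i) => c k.1 k.2)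
  have : FiniteDimensional ℂ V := FiniteDimensional.span_of_finite ℂ (Set.finite_range _)
  obtain ⟨P, hP⟩ := LinearMap.exists_leftInverse_of_injective V.subtype V.ker_subtype
  let e := Module.finBasis ℂ V
  have c_eq (i) (l) : c i l = ∑ k, e.coord k (P (c i l)) • (e k : A) := by
    have hV : c i l ∈ V := Submodule.subset_span ⟨⟨i, l⟩, rfl⟩
    rw [show P (c i l) = ⟨c i l, hV⟩ from LinearMap.congr_fun hP ⟨c i l, hV⟩]
    have h_sum := congrArg V.subtype (e.sum_repr ⟨c i l, hV⟩).symm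
    rw [map_sum] at h_sum
    exact h_sum
  refine ⟨_, fun k => e.coord k ∘ₗ P, fun k => e k, fun i => ?_⟩
  simp only [actL_of_comul _ (h i), TensorProduct.sum_tmul, TensorProduct.smul_tmul]
  rw [Finset.sum_comm, h i]
  exact Finset.sum_congr rfl fun l _ => by
    rw [← TensorProduct.tmul_sum]
    exact congrArg (b i l ⊗ₜ[ℂ] ·) (c_eq i l)

/-- `S'` is the inverse of the antipode. -/
lemma exists_antipode_inv [HopfAlgebra ℂ A]
    (hS : Function.Bijective (HopfAlgebra.antipode ℂ : A →ₗ[ℂ] A)) :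
    ∃ S' : A → A, ∀ {n : ℕ} {y : A} {b c : Fin n → A},
      Coalgebra.comul (R := ℂ) y = ∑ k, b k ⊗ₜ[ℂ] c k →
        ∑ k, S' (c k) * b k = algebraMap ℂ A (Coalgebra.counit y) := by
  choose S' hS' using hS.2
  refine ⟨S', fun {n y b c} hy => hS.1 ?_⟩
  have h := HopfAlgebra.mul_antipode_rTensor_comul_apply (R := ℂ) y
  rw [hy] at h
  simpa [HopfAlgebra.antipode_mul_antidistrib, hS', Algebra.algebraMap_eq_smul_one] using h

namespace IsInhomogeneous

variable [DecidableEq I]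

section Bialg

variable [Bialgebra ℂ A] [Bialgebra ℂ B] {Λ : Matrix I I A} {ι : A →ₐc[ℂ] B} {p : I → B}

lemma comul_p (hB : IsInhomogeneous Λ ι p) (i : I) :
    Coalgebra.comul (R := ℂ) (p i) =
      ∑ k : I ⊕ Unit, Sum.elim (fun u => ι (Λ i u)) (fun _ => p i) k ⊗ₜ[ℂ]
        Sum.elim p (fun _ => 1) k := by
  simpa [Pmat] using hB.isRep.1 (Sum.inl i) (Sum.inr ())

lemma actL_p (hB : IsInhomogeneous Λ ι p) (ρ : B →ₗ[ℂ] ℂ) (i : I) :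
    actL ρ (p i) = ∑ u, ρ (p u) • ι (Λ i u) + ρ 1 • p i := by
  simp [actL_of_comul ρ (hB.comul_p i)]

lemma actR_p (hB : IsInhomogeneous Λ ι p) (ρ : B →ₗ[ℂ] ℂ) (i : I) :
    actR ρ (p i) = ∑ u, ρ (ι (Λ i u)) • p u + ρ (p i) • 1 := by
  simp [actR_of_comul ρ (hB.comul_p i)]

lemma actL_mul_p (hB : IsInhomogeneous Λ ι p) (ρ : B →ₗ[ℂ] ℂ) (x : B) (i : I) :
    actL ρ (x * p i) =
      ∑ u, actL (ρ ∘ₗ LinearMap.mulRight ℂ (p u)) x * ι (Λ i u) + actL ρ x * p i := by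
  simp [actL_mul_right ρ x (hB.comul_p i)]

lemma actL_p_mul (hB : IsInhomogeneous Λ ι p) (ρ : B →ₗ[ℂ] ℂ) (x : B) (i : I) :
    actL ρ (p i * x) =
      ∑ u, ι (Λ i u) * actL (ρ ∘ₗ LinearMap.mulLeft ℂ (p u)) x + p i * actL ρ x := by
  simp [actL_mul_left ρ x (hB.comul_p i)]

lemma exists_dual_mod (hB : IsInhomogeneous Λ ι p) (hΛ : IsIrrep Λ) (j : I) :
    ∃ l : B →ₗ[ℂ] ℂ, (∀ a, l (ι a) = 0) ∧ ∀ i, l (p i) = if i = j then 1 else 0 := by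
  let K : Submodule ℂ (Module.Dual ℂ B) := (LinearMap.range (ι : A →ₗ[ℂ] B)).dualAnnihilator
  have mem_K (l : Module.Dual ℂ B) : l ∈ K ↔ ∀ a, l (ι a) = 0 := by
    simp [K, Submodule.mem_dualAnnihilator]
  let ev : Module.Dual ℂ B →ₗ[ℂ] I → ℂ := LinearMap.pi fun i => Module.Dual.eval ℂ B (p i)
  have invariant : IsInvariant Λ (K.map ev) := by
    rintro φ _ ⟨l, hl, rfl⟩
    have hl := (mem_K l).1 hl
    obtain ⟨ρ, rfl⟩ := exists_extend_dual hB.injective φ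
    refine ⟨l ∘ₗ actR ρ, (mem_K _).2 fun a => ?_, ?_⟩
    · exact (congrArg l (actR_map (ι : A →ₗc[ℂ] B) ρ a)).trans (hl _)
    · ext i
      have l_one : l 1 = 0 := by simpa using hl 1
      simp [ev, hB.actR_p, l_one, Matrix.mulVec, dotProduct]
  have ne_bot : K.map ev ≠ ⊥ := by
    obtain ⟨i, hi⟩ := hB.notMem
    obtain ⟨l, hli, hl⟩ := Submodule.exists_le_ker_of_notMem
      (p := LinearMap.range (ι : A →ₗ[ℂ] B)) hi
    refine fun h => hli (congrFun ((Submodule.eq_bot_iff _).1 h (ev l) ⟨l, ?_, rfl⟩) i)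
    exact (mem_K l).2 fun a => hl ⟨a, rfl⟩
  obtain ⟨l, hl, hlj⟩ : Pi.single j 1 ∈ K.map ev :=
    ((hΛ.2.2 _ invariant).resolve_left ne_bot).symm ▸ Submodule.mem_top
  refine ⟨l, (mem_K l).1 hl, fun i => ?_⟩
  exact (congrFun hlj i).trans (Pi.single_apply j 1 i)

lemma actL_mem_of_sum_mem (hB : IsInhomogeneous Λ ι p) {b : I → A}
    (hb : ∑ i, ι (b i) * p i ∈ Set.range ι) (ρ : A →ₗ[ℂ] ℂ) :
    ∑ i, ι (actL ρ (b i)) * p i ∈ Set.range ι := by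
  obtain ⟨σ, rfl⟩ := exists_extend_dual hB.injective ρ
  obtain ⟨a, ha⟩ := hb
  have actL_ι (σ : B →ₗ[ℂ] ℂ) (a : A) :
      actL σ (ι a) = ι (actL (σ ∘ₗ (ι : A →ₗ[ℂ] B)) a) := actL_map (ι : A →ₗc[ℂ] B) σ a
  have h := congrArg (actL σ) ha
  simp only [map_sum, hB.actL_mul_p, actL_ι, Finset.sum_add_distrib, ← map_mul] at h
  refine ⟨actL (σ ∘ₗ (ι : A →ₗ[ℂ] B)) a - ∑ i, ∑ u,
    actL ((σ ∘ₗ LinearMap.mulRight ℂ (p u)) ∘ₗ (ι : A →ₗ[ℂ] B)) (b i) * Λ i u, ?_⟩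
  simp only [map_sub, map_sum]
  exact sub_eq_of_eq_add' h

end Bialg

variable [HopfAlgebra ℂ A] [Bialgebra ℂ B] {Λ : Matrix I I A} {ι : A →ₐc[ℂ] B} {p : I → B}

lemma eq_zero_of_sum_mem (hB : IsInhomogeneous Λ ι p) (hΛ : HomogeneousData Λ)
    {a : I → A} (ha : ∑ i, ι (a i) * p i ∈ Set.range ι) : a = 0 := by
  let K : Submodule A (I → A) :=
    { carrier := {b | ∑ i, ι (b i) * p i ∈ Set.range ι}
      add_mem' := by
        rintro b c ⟨x, hx⟩ ⟨y, hy⟩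
        exact ⟨x + y, by simp [hx, hy, add_mul, Finset.sum_add_distrib]⟩
      zero_mem' := ⟨0, by simp⟩
      smul_mem' := by
        rintro c b ⟨x, hx⟩
        exact ⟨c * x, by simp [hx, Finset.mul_sum, mul_assoc]⟩ }
  obtain ⟨S', hS'⟩ := exists_antipode_inv hΛ.antipode_bijective
  have counit_mem {b : I → A} (hb : b ∈ K) :
      (fun i => algebraMap ℂ A (Coalgebra.counit (b i))) ∈ K := by
    obtain ⟨n, ρ, c, h⟩ := exists_comul_eq_sum_actL b
    have h_sum : (fun i => algebraMap ℂ A (Coalgebra.counit (b i))) =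
        ∑ k, S' (c k) • fun i => actL (ρ k) (b i) := by
      ext i
      simp [← hS' (h i)]
    rw [h_sum]
    exact K.sum_mem fun k _ => K.smul_mem _ (hB.actL_mem_of_sum_mem hb (ρ k))
  have counit_eq_zero {b : I → A} (hb : b ∈ K) (j : I) : Coalgebra.counit (R := ℂ) (b j) = 0 := by
    obtain ⟨x, hx⟩ := counit_mem hb
    obtain ⟨l, hl, hlp⟩ := hB.exists_dual_mod hΛ.irreducible j
    have h := congrArg l hx
    simpa [hl, hlp, Algebra.algebraMap_eq_smul_one] using h.symm
  ext i
  refine eq_of_forall_dual fun ρ => ?_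
  rw [← counit_actL, Pi.zero_apply, map_zero]
  exact counit_eq_zero (hB.actL_mem_of_sum_mem ha ρ) i

lemma gamMap_injective (hB : IsInhomogeneous Λ ι p) (hΛ : HomogeneousData Λ) :
    Function.Injective (gamMap (ι : A →ₐ[ℂ] B) p) := by
  refine LinearMap.ker_eq_bot.1 (LinearMap.ker_eq_bot'.2 fun ⟨a, b⟩ h => ?_)
  rw [gamMap_apply] at h
  have a_eq : a = 0 :=
    hB.eq_zero_of_sum_mem hΛ ⟨-b, by rw [map_neg]; exact neg_eq_of_add_eq_zero_left h⟩
  subst a_eq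
  exact Prod.ext rfl (hB.injective (by simpa using h))

end IsInhomogeneous

end Freeness

section Intertwiners

variable {A I J K : Type*} [Ring A] [Fintype I] [DecidableEq I] [Fintype J] [DecidableEq J]
  [Fintype K] [DecidableEq K]

section Bialg

variable [Bialgebra ℂ A]

lemma IsRep.submatrix {w : Matrix J J A} (hw : IsRep w) (e : K ≃ J) :
    IsRep (w.submatrix e e) := by
  refine ⟨fun i j => ?_, fun i j => ?_⟩
  · simp only [Matrix.submatrix_apply, hw.1]
    exact (e.sum_comp fun k => w (e i) k ⊗ₜ[ℂ] w k (e j)).symm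
  · simp [hw.2, Matrix.one_apply]

lemma IsInvariant.comap_submatrix {m n : Type*} [Fintype m] [Fintype n] {w : Matrix m m A}
    {e : n ≃ m} {W : Submodule ℂ (n → ℂ)} (hW : IsInvariant (w.submatrix e e) W) :
    IsInvariant w (W.comap (LinearEquiv.funCongrLeft ℂ ℂ e).toLinearMap) := fun φ x hx => by
  have h : (w.map φ).mulVec x ∘ e = ((w.submatrix e e).map φ).mulVec (x ∘ e) := by
    rw [← Matrix.submatrix_map, Matrix.submatrix_mulVec_equiv]
    simp [Function.comp_assoc]
  exact (congrArg (· ∈ W) h).mpr (hW φ _ hx)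

lemma IsIrrep.submatrix {w : Matrix J J A} (hw : IsIrrep w) (e : K ≃ J) :
    IsIrrep (w.submatrix e e) := by
  obtain ⟨hrep, hne, hirr⟩ := hw
  let E := LinearEquiv.funCongrLeft ℂ ℂ e
  refine ⟨hrep.submatrix e, e.nonempty, fun W hW => ?_⟩
  have hW_eq : W = (W.comap E.toLinearMap).map E.toLinearMap :=
    (Submodule.map_comap_eq_of_surjective E.surjective W).symm
  rcases hirr _ hW.comap_submatrix with h | h
  · left
    rw [hW_eq, h, Submodule.map_bot]
  · right
    rw [hW_eq, h, Submodule.map_top, E.range]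

lemma isIrrep_one [Unique K] : IsIrrep (1 : Matrix K K A) := by
  refine ⟨⟨fun i j => ?_, fun i j => ?_⟩, inferInstance, fun W _ => ?_⟩
  · rw [Fintype.sum_unique, Unique.eq_default i, Unique.eq_default j, Matrix.one_apply_eq,
      Bialgebra.comul_one, Algebra.TensorProduct.one_def]
  · rw [Unique.eq_default i, Unique.eq_default j, Matrix.one_apply_eq, Matrix.one_apply_eq,
      Bialgebra.counit_one]
  · have : IsSimpleOrder (Submodule ℂ (K → ℂ)) :=
      (isSimpleModule_iff ..).1
        ((LinearEquiv.funUnique K ℂ ℂ).isSimpleModule_iff.2 inferInstance)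
    exact eq_bot_or_eq_top W

lemma IsMor.submatrix {m n m' n' : Type*} [Fintype m] [Fintype n] [Fintype m'] [Fintype n']
    {v : Matrix m m A} {w : Matrix n n A} {M : Matrix n m ℂ} (h : IsMor v w M)
    (e : m' ≃ m) (e' : n' ≃ n) :
    IsMor (v.submatrix e e) (w.submatrix e' e') (M.submatrix e' e) := by
  have h' := congrArg (fun X => Matrix.submatrix X e' e) h
  rwa [← Matrix.submatrix_mul_equiv _ _ _ e, ← Matrix.submatrix_mul_equiv _ _ _ e'] at h'

lemma IsRep.tmul {m n : Type*} [Fintype m] [DecidableEq m] [Fintype n] [DecidableEq n]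
    {v : Matrix m m A} {w : Matrix n n A} (hv : IsRep v) (hw : IsRep w) :
    IsRep (Matrix.of fun x y : m × n => v x.1 y.1 ⊗ₜ[ℂ] w x.2 y.2) := by
  refine ⟨fun x y => ?_, fun x y => ?_⟩
  · simp only [Matrix.of_apply, TensorProduct.comul_tmul, hv.1, hw.1, TensorProduct.sum_tmul,
      TensorProduct.tmul_sum, map_sum,
      TensorProduct.AlgebraTensorModule.tensorTensorTensorComm_tmul, Fintype.sum_prod_type]
    exact Finset.sum_comm
  · rw [Matrix.of_apply, TensorProduct.counit_tmul, hv.2, hw.2, smul_eq_mul, mul_comm,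
      ← Matrix.one_kronecker_one]
    rfl

end Bialg

variable [HopfAlgebra ℂ A] {Λ : Matrix I I A}

lemma HomogeneousData.isRep (hΛ : HomogeneousData Λ) : IsRep Λ := hΛ.irreducible.1

lemma HomogeneousData.mor_irrep_eq_zero (hΛ : HomogeneousData Λ) {w : Matrix J J A}
    (hw : IsIrrep w) {M : Matrix (I × J) J ℂ} (hM : IsMor w (Λ ⊗ₖ w) M) : M = 0 := by
  let e := (Fintype.equivFin J).symm
  let g : Fin 1 × Fin (Fintype.card J) ≃ J := (Equiv.uniqueProd _ _).trans e
  have one_kronecker : (1 : Matrix (Fin 1) (Fin 1) A) ⊗ₖ w.submatrix e e = w.submatrix g g := by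
    ext x y
    simp [g, Matrix.one_apply, Subsingleton.elim x.1 y.1]
  have h := hΛ.mor_eq_zero 1 _ 1 (w.submatrix e e) isIrrep_one (hw.submatrix e)
    (M.submatrix (Equiv.prodCongrRight fun _ => g) g) (by
      rw [one_kronecker]
      exact hM.submatrix g _)
  exact (Matrix.reindex (Equiv.prodCongrRight fun _ => g).symm g.symm).injective h

/-- The form in which `Mor(v ⊗ w, Λ ⊗ v ⊗ w) = 0` is used for functionals of two arguments. -/
lemma HomogeneousData.tensor_functional_eq_zero (hΛ : HomogeneousData Λ)
    {θ : I → A ⊗[ℂ] A →ₗ[ℂ] ℂ} (hθ : ∀ i z, LinearMap.mul' ℂ A (actR (θ i) z) =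
      ∑ t, Λ i t * LinearMap.mul' ℂ A (actL (θ t) z)) : θ = 0 := by
  ext i : 1
  refine TensorProduct.ext (linearMap_ext_irrep hΛ.completelyReducible fun m v hv c d =>
    linearMap_ext_irrep hΛ.completelyReducible fun n w hw c' d' => ?_)
  have hvw := hv.1.tmul hw.1
  let M : Matrix (I × (Fin m × Fin n)) (Fin m × Fin n) ℂ :=
    Matrix.of fun x y => θ x.1 (v x.2.1 y.1 ⊗ₜ[ℂ] w x.2.2 y.2)
  have isMor : IsMor (v ⊗ₖ w) (Λ ⊗ₖ (v ⊗ₖ w)) M := by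
    ext ⟨i, z⟩ y
    have h := hθ i (v z.1 y.1 ⊗ₜ[ℂ] w z.2 y.2)
    have hR := hvw.actR (θ i) z y
    have hL t := hvw.actL (θ t) z y
    simp only [Matrix.of_apply] at hR hL
    rw [hR] at h
    simp only [hL] at h
    simpa [M, scal, Matrix.mul_apply, Finset.mul_sum, Algebra.smul_def,
      Algebra.commutes, mul_assoc, Fintype.sum_prod_type] using h
  exact congrArg (fun X => X (i, c, c') (d, d')) (hΛ.mor_eq_zero m n v w hv hw M isMor)

end Intertwiners

section Exchange

variable {A B C I : Type*} [Ring A] [Ring B] [Ring C] [Fintype I]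

/-- The rule `q_s a = F_st(a) q_t + h_s(a)` for moving elements of `A` to the left of the `q_s`. -/
def IsExchange [Bialgebra ℂ A] [Algebra ℂ C] (φ : A →ₐ[ℂ] C) (q : I → C)
    (F : I → I → A →ₗ[ℂ] A) (h : I → A →ₗ[ℂ] A) : Prop :=
  ∀ s a, q s * φ a = ∑ t, φ (F s t a) * q t + φ (h s a)

/-- The derivation-like map `a ↦ a * η_s - Λ_st (η_t * a)` occurring in `CrossRel`. -/
def coboundary [Bialgebra ℂ A] (Λ : Matrix I I A) (η : I → A →ₗ[ℂ] ℂ) (s : I) : A →ₗ[ℂ] A :=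
  actR (η s) - ∑ t, LinearMap.mulLeft ℂ (Λ s t) ∘ₗ actL (η t)

/-- The intertwining condition on the leading coefficients `f` in `IsStructureData`. -/
def Intertwines [Bialgebra ℂ A] (Λ : Matrix I I A) (f : I → I → A →ₗ[ℂ] ℂ) : Prop :=
  ∀ s r a, ∑ t, Λ s t * actL (f t r) a = ∑ t, actR (f s t) a * Λ t r

/-- The cocycle identity `Δ h_s(a) = Λ_su a₍₁₎ ⊗ h_u(a₍₂₎) + h_s(a₍₁₎) ⊗ a₍₂₎`, tested on the
slices `id ⊗ ρ`. -/
def IsCocycle [Bialgebra ℂ A] (Λ : Matrix I I A) (h : I → A →ₗ[ℂ] A) : Prop :=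
  ∀ (ρ : A →ₗ[ℂ] ℂ) s a, actL ρ (h s a) = ∑ u, Λ s u * actL (ρ ∘ₗ h u) a + h s (actL ρ a)

lemma coboundary_apply [Bialgebra ℂ A] (Λ : Matrix I I A) (η : I → A →ₗ[ℂ] ℂ) (s : I) (a : A) :
    coboundary Λ η s a = actR (η s) a - ∑ t, Λ s t * actL (η t) a := by
  simp [coboundary]

lemma crossRel_iff_isExchange [Bialgebra ℂ A] [Algebra ℂ C] {φ : A →ₐ[ℂ] C}
    {q : I → C} {Λ : Matrix I I A} {f : I → I → A →ₗ[ℂ] ℂ} {η : I → A →ₗ[ℂ] ℂ} :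
    CrossRel φ q Λ f η ↔ IsExchange φ q (fun s t => actR (f s t)) (coboundary Λ η) := by
  simp only [CrossRel, IsExchange, coboundary_apply, map_sub, map_sum, add_sub_assoc]

section Coefficients

variable [Bialgebra ℂ A] [Algebra ℂ C] {φ : A →ₐ[ℂ] C} {q : I → C}

lemma exists_coordinates [DecidableEq I] (hinj : Function.Injective (gamMap φ q)) :
    ∃ P : C →ₗ[ℂ] (I → A) × A, (∀ x, P (gamMap φ q x) = x) ∧ (∀ b, P (φ b) = (0, b)) ∧
      ∀ a i, P (φ a * q i) = (Pi.single i a, 0) := by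
  obtain ⟨P, hP⟩ := LinearMap.exists_leftInverse_of_injective _ (LinearMap.ker_eq_bot.2 hinj)
  have hP := LinearMap.congr_fun hP
  refine ⟨P, hP, fun b => ?_, fun a i => ?_⟩
  · simpa using hP (0, b)
  · exact gamMap_single φ q i a ▸ hP (Pi.single i a, 0)

/-- The functionals `ε ∘ bᵣ` in terms of the coordinates `bᵣ` of `∑ bᵢ qᵢ + c ∈ Γ`. -/
lemma exists_fst_dual [DecidableEq I] (hinj : Function.Injective (gamMap φ q)) (r : I) :
    ∃ σ : C →ₗ[ℂ] ℂ, (∀ x, σ (gamMap φ q x) = Coalgebra.counit (R := ℂ) (x.1 r)) ∧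
      σ ∘ₗ φ.toLinearMap = 0 ∧ ∀ u, (σ ∘ₗ LinearMap.mulRight ℂ (q u)) ∘ₗ φ.toLinearMap =
        (1 : Matrix I I ℂ) r u • Coalgebra.counit := by
  obtain ⟨P, hP, hPφ, hPq⟩ := exists_coordinates hinj
  let ε_fst : (I → A) × A →ₗ[ℂ] ℂ :=
    Coalgebra.counit ∘ₗ LinearMap.proj r ∘ₗ LinearMap.fst ℂ _ _
  refine ⟨ε_fst ∘ₗ P, fun x => congrArg ε_fst (hP x), ?_, fun u => ?_⟩
  · ext a
    simp [ε_fst, hPφ]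
  · ext a
    rcases eq_or_ne r u with rfl | hr
    · simp [ε_fst, hPq]
    · simp [ε_fst, hPq, hr]

lemma exists_isExchange (hinj : Function.Injective (gamMap φ q))
    (hmul : ∀ s a, q s * φ a ∈ Gam φ q) : ∃ F h, IsExchange φ q F h := by
  classical
  obtain ⟨P, hP, -⟩ := exists_coordinates hinj
  let E (s : I) : A →ₗ[ℂ] (I → A) × A := P ∘ₗ LinearMap.mulLeft ℂ (q s) ∘ₗ φ.toLinearMap
  refine ⟨fun s t => LinearMap.proj t ∘ₗ LinearMap.fst ℂ _ _ ∘ₗ E s,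
    fun s => LinearMap.snd ℂ _ _ ∘ₗ E s, fun s a => ?_⟩
  obtain ⟨x, hx⟩ := (range_gamMap φ q).ge (hmul s a)
  have E_eq : E s a = x := (congrArg P hx).symm.trans (hP x)
  rw [← hx, gamMap_apply, ← E_eq]
  rfl

variable {F : I → I → A →ₗ[ℂ] A} {h : I → A →ₗ[ℂ] A}

lemma IsExchange.gamMap_eq (hE : IsExchange φ q F h) (s : I) (a : A) :
    gamMap φ q (fun t => F s t a, h s a) = q s * φ a := by
  rw [gamMap_apply, hE]

lemma IsExchange.map_mul (hinj : Function.Injective (gamMap φ q)) (hE : IsExchange φ q F h)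
    (s : I) (a b : A) :
    (fun u => F s u (a * b), h s (a * b)) =
      (fun u => ∑ t, F s t a * F t u b, ∑ t, F s t a * h t b + h s a * b) := by
  refine hinj ?_
  rw [hE.gamMap_eq, _root_.map_mul, ← mul_assoc, hE, add_mul, Finset.sum_mul]
  simp only [mul_assoc, hE _ b, mul_add, Finset.sum_add_distrib, Finset.mul_sum, gamMap_apply,
    map_add, map_sum, _root_.map_mul, Finset.sum_mul, ← add_assoc]
  rw [Finset.sum_comm]

lemma IsExchange.map_one [DecidableEq I] (hinj : Function.Injective (gamMap φ q))
    (hE : IsExchange φ q F h) (s : I) :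
    (fun t => F s t 1, h s 1) = (Pi.single s 1, 0) := by
  refine hinj ?_
  rw [hE.gamMap_eq, gamMap_single, _root_.map_one, mul_one, one_mul]

variable {f : I → I → A →ₗ[ℂ] ℂ}

lemma leading_mul (hinj : Function.Injective (gamMap φ q))
    (hE : IsExchange φ q (fun s t => actR (f s t)) h) (s u : I) (a b : A) :
    f s u (a * b) = ∑ t, f s t a * f t u b := by
  have h_actR := congrFun (congrArg Prod.fst (hE.map_mul hinj s a b)) u
  simpa [Bialgebra.counit_mul] using congrArg (Coalgebra.counit (R := ℂ)) h_actR

lemma leading_one [DecidableEq I] (hinj : Function.Injective (gamMap φ q))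
    (hE : IsExchange φ q (fun s t => actR (f s t)) h) (s t : I) :
    f s t 1 = (1 : Matrix I I ℂ) s t := by
  have h_actR := congrFun (congrArg Prod.fst (hE.map_one hinj s)) t
  simpa [Matrix.one_apply, Pi.single_apply, apply_ite, eq_comm] using
    congrArg (Coalgebra.counit (R := ℂ)) h_actR

lemma isLeading_iff : IsLeading φ q f ↔
    ∀ s a, ∃ b, gamMap φ q (fun t => actR (f s t) a, b) = q s * φ a := by
  simp only [IsLeading, gamMap_apply, Set.mem_range, eq_sub_iff_add_eq']

lemma IsLeading.eq (hinj : Function.Injective (gamMap φ q)) {f' : I → I → A →ₗ[ℂ] ℂ}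
    (hf : IsLeading φ q f) (hf' : IsLeading φ q f') : f = f' := by
  ext s t a
  obtain ⟨b, hb⟩ := isLeading_iff.1 hf s a
  obtain ⟨b', hb'⟩ := isLeading_iff.1 hf' s a
  have h_actR := congrFun (congrArg Prod.fst (hinj (hb.trans hb'.symm))) t
  simpa using congrArg (Coalgebra.counit (R := ℂ)) h_actR

lemma IsExchange.isLeading (hE : IsExchange φ q (fun s t => actR (f s t)) h) :
    IsLeading φ q f :=
  isLeading_iff.2 fun s a => ⟨_, hE.gamMap_eq s a⟩

end Coefficients

namespace IsInhomogeneous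

variable [DecidableEq I] [HopfAlgebra ℂ A] [Bialgebra ℂ B] {Λ : Matrix I I A} {ι : A →ₐc[ℂ] B}
  {p : I → B} {F : I → I → A →ₗ[ℂ] A} {h : I → A →ₗ[ℂ] A}

lemma mul_mem_gam (hB : IsInhomogeneous Λ ι p) (s : I) (a : A) :
    p s * ι a ∈ Gam (ι : A →ₐ[ℂ] B) p :=
  hB.mul_mem _ (Submodule.mem_sup_left (Submodule.subset_span ⟨(1, s), by simp⟩)) a

lemma actL_isExchange (hB : IsInhomogeneous Λ ι p) (hΛ : HomogeneousData Λ)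
    (hE : IsExchange (ι : A →ₐ[ℂ] B) p F h) (σ : B →ₗ[ℂ] ℂ) (s : I) (a : A) :
    (fun t => F s t (actL (σ ∘ₗ (ι : A →ₗ[ℂ] B)) a),
      ∑ u, Λ s u * actL ((σ ∘ₗ LinearMap.mulLeft ℂ (p u)) ∘ₗ (ι : A →ₗ[ℂ] B)) a +
        h s (actL (σ ∘ₗ (ι : A →ₗ[ℂ] B)) a)) =
    (fun t => actL (σ ∘ₗ (ι : A →ₗ[ℂ] B)) (F s t a),
      ∑ t, ∑ u, actL ((σ ∘ₗ LinearMap.mulRight ℂ (p u)) ∘ₗ (ι : A →ₗ[ℂ] B)) (F s t a) * Λ t u +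
        actL (σ ∘ₗ (ι : A →ₗ[ℂ] B)) (h s a)) := by
  have actL_ι (σ : B →ₗ[ℂ] ℂ) (a : A) :
      actL σ (ι a) = ι (actL (σ ∘ₗ (ι : A →ₗ[ℂ] B)) a) := actL_map (ι : A →ₗc[ℂ] B) σ a
  have hE' (s a) : p s * ι a = ∑ t, ι (F s t a) * p t + ι (h s a) := hE s a
  have h_actL := congrArg (actL σ) (hE' s a)
  rw [hB.actL_p_mul] at h_actL
  simp only [map_add, map_sum, hB.actL_mul_p, actL_ι, hE', Finset.sum_add_distrib] at h_actL
  refine hB.gamMap_injective hΛ ?_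
  simp only [gamMap_apply, map_add, map_sum, map_mul, BialgHom.coe_toAlgHom]
  rw [add_left_comm, h_actL]
  abel

lemma exists_isExchange_leading (hB : IsInhomogeneous Λ ι p) (hΛ : HomogeneousData Λ) :
    ∃ (f : I → I → A →ₗ[ℂ] ℂ) (h : I → A →ₗ[ℂ] A),
      IsExchange (ι : A →ₐ[ℂ] B) p (fun s t => actR (f s t)) h := by
  obtain ⟨F, h, hE⟩ := exists_isExchange (hB.gamMap_injective hΛ) hB.mul_mem_gam
  have F_actL (ρ : A →ₗ[ℂ] ℂ) (s t a) : F s t (actL ρ a) = actL ρ (F s t a) := by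
    obtain ⟨σ, rfl⟩ := exists_extend_dual hB.injective ρ
    exact congrFun (congrArg Prod.fst (hB.actL_isExchange hΛ hE σ s a)) t
  have F_eq (s t a) : actR (Coalgebra.counit ∘ₗ F s t) a = F s t a :=
    eq_of_forall_dual fun ρ => by
      rw [← dual_actL, LinearMap.comp_apply, F_actL, counit_actL]
  exact ⟨fun s t => Coalgebra.counit ∘ₗ F s t, h, by simpa only [IsExchange, F_eq] using hE⟩

variable {f : I → I → A →ₗ[ℂ] ℂ}

lemma intertwines_leading (hB : IsInhomogeneous Λ ι p) (hΛ : HomogeneousData Λ)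
    (hE : IsExchange (ι : A →ₐ[ℂ] B) p (fun s t => actR (f s t)) h) : Intertwines Λ f := by
  intro s r a
  obtain ⟨σ, σ_gamMap, σ_ι, σ_mul_p⟩ := exists_fst_dual (hB.gamMap_injective hΛ) r
  have σ_ι : σ ∘ₗ (ι : A →ₗ[ℂ] B) = 0 := σ_ι
  have σ_mul_p (u) : (σ ∘ₗ LinearMap.mulRight ℂ (p u)) ∘ₗ (ι : A →ₗ[ℂ] B) =
      (1 : Matrix I I ℂ) r u • Coalgebra.counit := σ_mul_p u
  have σ_p_mul (u) : (σ ∘ₗ LinearMap.mulLeft ℂ (p u)) ∘ₗ (ι : A →ₗ[ℂ] B) = f u r := by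
    ext a
    simpa using (congrArg σ (hE.gamMap_eq u a)).symm.trans (σ_gamMap _)
  have h_slice := congrArg Prod.snd (hB.actL_isExchange hΛ hE σ s a)
  simp only [σ_ι, σ_p_mul, σ_mul_p, actL_smul, actL_counit] at h_slice
  simpa [Matrix.one_apply] using h_slice

lemma isCocycle_remainder (hB : IsInhomogeneous Λ ι p) (hΛ : HomogeneousData Λ)
    (hE : IsExchange (ι : A →ₐ[ℂ] B) p F h) : IsCocycle Λ h := by
  intro ρ s a
  obtain ⟨P, hP, hPι, hPp⟩ := exists_coordinates (hB.gamMap_injective hΛ)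
  let σ : B →ₗ[ℂ] ℂ := ρ ∘ₗ LinearMap.snd ℂ _ _ ∘ₗ P
  have σ_ι : σ ∘ₗ (ι : A →ₗ[ℂ] B) = ρ := LinearMap.ext fun a =>
    congrArg (fun x => ρ x.2) (hPι a)
  have σ_p_mul (u) : (σ ∘ₗ LinearMap.mulLeft ℂ (p u)) ∘ₗ (ι : A →ₗ[ℂ] B) = ρ ∘ₗ h u :=
    LinearMap.ext fun a =>
      congrArg (fun x => ρ x.2) ((congrArg P (hE.gamMap_eq u a)).symm.trans (hP _))
  have σ_mul_p (u) : (σ ∘ₗ LinearMap.mulRight ℂ (p u)) ∘ₗ (ι : A →ₗ[ℂ] B) = 0 :=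
    LinearMap.ext fun a => (congrArg (fun x => ρ x.2) (hPp a u)).trans (map_zero ρ)
  have h_slice := congrArg Prod.snd (hB.actL_isExchange hΛ hE σ s a)
  simpa [σ_ι, σ_p_mul, σ_mul_p] using h_slice.symm

end IsInhomogeneous

end Exchange

section Coboundary

variable {A I n : Type*} [Ring A] [HopfAlgebra ℂ A] [Fintype I] [Fintype n] [DecidableEq n]
  {Λ : Matrix I I A} {h : I → A →ₗ[ℂ] A} {w : Matrix n n A} {χ : A →ₗ[ℂ] ℂ}

/-- The entrywise slice map `id ⊗ χ`. -/
def sliceMatrix (χ : A →ₗ[ℂ] ℂ) : Matrix n n (A ⊗[ℂ] A) →ₗ[ℂ] Matrix n n A :=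
  ((TensorProduct.rid ℂ A).toLinearMap ∘ₗ LinearMap.lTensor A χ).mapMatrix

lemma sliceMatrix_legOne_mul_legTwo_mul_legOne (M K N : Matrix n n A) :
    sliceMatrix χ (legOne M * legTwo K * legOne N) = M * scal A (K.map χ) * N := by
  ext c d
  simp [sliceMatrix, scal, Matrix.mul_apply, Finset.sum_mul, Algebra.algebraMap_eq_smul_one]

lemma sliceMatrix_comulMatrix (hχ : ∀ a, actL χ a = χ a • (1 : A)) (M : Matrix n n A) :
    sliceMatrix χ (comulMatrix M) = scal A (M.map χ) := by
  ext c d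
  exact (hχ (M c d)).trans (Algebra.algebraMap_eq_smul_one _).symm

lemma comulMatrix_remainder (hh : IsCocycle Λ h) (hw : IsRep w) (s : I) :
    comulMatrix (w.map (h s)) =
      ∑ u, legOne (Λ s u • w) * legTwo (w.map (h u)) + legOne (w.map (h s)) * legTwo w := by
  ext c d
  refine tensor_eq_of_slices fun ρ => (TensorProduct.rid ℂ A).injective ?_
  refine (hh ρ s (w c d)).trans ?_
  simp [hw.actL, Matrix.mul_apply, Matrix.sum_apply, Finset.mul_sum]

/-- Averaging the cocycle identity of `h` against the Haar functional `χ`. -/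
lemma scal_haar_mul (hχ_one : χ 1 = 1) (hχ : ∀ a, actL χ a = χ a • (1 : A))
    (hh : IsCocycle Λ h)
    (hw : IsRep w) {H : I → Matrix n n ℂ}
    (hH : ∀ s, H s = (w.map (h s) * w.map (HopfAlgebra.antipode ℂ)).map χ) (s : I) :
    scal A (H s) * w = ∑ u, Λ s u • (w * scal A (H u)) + w.map (h s) := by
  let w' := w.map (HopfAlgebra.antipode ℂ)
  have scal_H : scal A (H s) =
      ∑ u, Λ s u • w * scal A (H u) * w' + w.map (h s) * w' := by
    have h_comul := congrArg (sliceMatrix χ) (map_mul comulMatrix (w.map (h s)) w')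
    rw [sliceMatrix_comulMatrix hχ, comulMatrix_remainder hh hw, hw.comulMatrix_antipode, add_mul,
      Finset.sum_mul, map_add, map_sum] at h_comul
    simp only [mul_assoc (legOne _), ← mul_assoc (legTwo _) (legTwo _), ← map_mul legTwo] at h_comul
    simp only [← mul_assoc (legOne _)] at h_comul
    simp only [sliceMatrix_legOne_mul_legTwo_mul_legOne, hw.mul_map_antipode] at h_comul
    simpa [hH, hχ_one, scal, Matrix.map_one] using h_comul
  rw [scal_H, add_mul, Finset.sum_mul]
  simp only [mul_assoc _ w' w, w', hw.map_antipode_mul, mul_one, Matrix.smul_mul]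

lemma exists_eq_coboundary
    (hcr : ∀ (n : ℕ) (v : Matrix (Fin n) (Fin n) A), IsRep v → IsCompletelyReducible v)
    (hS : Function.Injective (HopfAlgebra.antipode ℂ : A →ₗ[ℂ] A))
    (hh : IsCocycle Λ h) :
    ∃ η : I → A →ₗ[ℂ] ℂ, h = coboundary Λ η := by
  obtain ⟨χ, χ_one, actL_χ⟩ := exists_haar hS hcr
  let η : I → A →ₗ[ℂ] ℂ := fun s => χ ∘ₗ LinearMap.mul' ℂ A ∘ₗ
    TensorProduct.map (h s) (HopfAlgebra.antipode ℂ) ∘ₗ Coalgebra.comul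
  refine ⟨η, funext fun s => linearMap_ext_irrep hcr fun n w hw c d => ?_⟩
  have η_w (s) : w.map (η s) = (w.map (h s) * w.map (HopfAlgebra.antipode ℂ)).map χ := by
    ext c d
    simp [η, hw.1.1, Matrix.mul_apply]
  have h_entry := congrArg (fun X : Matrix (Fin n) (Fin n) A => X c d)
    (scal_haar_mul χ_one actL_χ hh hw.1 η_w s)
  rw [coboundary_apply, eq_sub_iff_add_eq', hw.1.actR]
  simp only [hw.1.actL]
  simpa [Matrix.mul_apply, Matrix.sum_apply, scal, Algebra.smul_def, Algebra.commutes] using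
    h_entry.symm

end Coboundary

section CoboundaryMul

variable {A I : Type*} [Ring A]

section Bialg

variable [Bialgebra ℂ A]

lemma actL_sub (ρ σ : A →ₗ[ℂ] ℂ) (x : A) : actL (ρ - σ) x = actL ρ x - actL σ x := by
  simp [actL, LinearMap.lTensor_sub]

lemma actR_sub (ρ σ : A →ₗ[ℂ] ℂ) (x : A) : actR (ρ - σ) x = actR ρ x - actR σ x := by
  simp [actR, LinearMap.rTensor_sub]

lemma actL_sum {κ : Type*} (s : Finset κ) (ρ : κ → A →ₗ[ℂ] ℂ) (x : A) :
    actL (∑ t ∈ s, ρ t) x = ∑ t ∈ s, actL (ρ t) x :=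
  eq_of_forall_dual fun g => by simp [dual_actL]

lemma actR_sum {κ : Type*} (s : Finset κ) (ρ : κ → A →ₗ[ℂ] ℂ) (x : A) :
    actR (∑ t ∈ s, ρ t) x = ∑ t ∈ s, actR (ρ t) x :=
  eq_of_forall_dual fun g => by simp [← dual_actL]

lemma comul_tmul_of_comul {κ κ' : Type*} [Fintype κ] [Fintype κ'] {a b : A} {a₁ a₂ : κ → A}
    {b₁ b₂ : κ' → A} (ha : Coalgebra.comul (R := ℂ) a = ∑ k, a₁ k ⊗ₜ[ℂ] a₂ k)
    (hb : Coalgebra.comul (R := ℂ) b = ∑ k, b₁ k ⊗ₜ[ℂ] b₂ k) :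
    Coalgebra.comul (R := ℂ) (a ⊗ₜ[ℂ] b) =
      ∑ z : κ × κ', (a₁ z.1 ⊗ₜ[ℂ] b₁ z.2) ⊗ₜ[ℂ] (a₂ z.1 ⊗ₜ[ℂ] b₂ z.2) := by
  simp [TensorProduct.comul_tmul, ha, hb, TensorProduct.sum_tmul, TensorProduct.tmul_sum,
    Fintype.sum_prod_type_right]

lemma actL_tmul (g g' : A →ₗ[ℂ] ℂ) (a b : A) :
    actL (LinearMap.mul' ℂ ℂ ∘ₗ TensorProduct.map g g') (a ⊗ₜ[ℂ] b) =
      actL g a ⊗ₜ[ℂ] actL g' b := by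
  obtain ⟨m, a₁, a₂, ha⟩ := exists_comul_eq a
  obtain ⟨n, b₁, b₂, hb⟩ := exists_comul_eq b
  rw [actL_of_comul _ (comul_tmul_of_comul ha hb), actL_of_comul g ha, actL_of_comul g' hb]
  simp [TensorProduct.sum_tmul, TensorProduct.tmul_sum, TensorProduct.smul_tmul', mul_comm,
    Fintype.sum_prod_type_right, smul_smul, Finset.smul_sum]

lemma actR_tmul (g g' : A →ₗ[ℂ] ℂ) (a b : A) :
    actR (LinearMap.mul' ℂ ℂ ∘ₗ TensorProduct.map g g') (a ⊗ₜ[ℂ] b) =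
      actR g a ⊗ₜ[ℂ] actR g' b := by
  obtain ⟨m, a₁, a₂, ha⟩ := exists_comul_eq a
  obtain ⟨n, b₁, b₂, hb⟩ := exists_comul_eq b
  rw [actR_of_comul _ (comul_tmul_of_comul ha hb), actR_of_comul g ha, actR_of_comul g' hb]
  simp [TensorProduct.sum_tmul, TensorProduct.tmul_sum, TensorProduct.smul_tmul', mul_comm,
    Fintype.sum_prod_type_right, smul_smul, Finset.smul_sum]

end Bialg

variable [HopfAlgebra ℂ A] [Fintype I] [DecidableEq I] {Λ : Matrix I I A}
  {f : I → I → A →ₗ[ℂ] ℂ} {η : I → A →ₗ[ℂ] ℂ}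

lemma coboundary_mul (hΛ : HomogeneousData Λ) (hf : Intertwines Λ f)
    (hη : ∀ s a b, coboundary Λ η s (a * b) =
      ∑ t, actR (f s t) a * coboundary Λ η t b + coboundary Λ η s a * b) (s : I) (a b : A) :
    η s (a * b) = ∑ t, f s t a * η t b + η s a * Coalgebra.counit (R := ℂ) b := by
  let tmul (g g' : A →ₗ[ℂ] ℂ) : A ⊗[ℂ] A →ₗ[ℂ] ℂ := LinearMap.mul' ℂ ℂ ∘ₗ TensorProduct.map g g'
  let θ (s : I) : A ⊗[ℂ] A →ₗ[ℂ] ℂ :=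
    η s ∘ₗ LinearMap.mul' ℂ A - ∑ t, tmul (f s t) (η t) - tmul (η s) Coalgebra.counit
  have actL_mul (ρ : A →ₗ[ℂ] ℂ) (z : A ⊗[ℂ] A) :
      LinearMap.mul' ℂ A (actL (ρ ∘ₗ LinearMap.mul' ℂ A) z) = actL ρ (LinearMap.mul' ℂ A z) :=
    (actL_map (Bialgebra.mulCoalgHom ℂ A) ρ z).symm
  have actR_mul (ρ : A →ₗ[ℂ] ℂ) (z : A ⊗[ℂ] A) :
      LinearMap.mul' ℂ A (actR (ρ ∘ₗ LinearMap.mul' ℂ A) z) = actR ρ (LinearMap.mul' ℂ A z) :=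
    (actR_map (Bialgebra.mulCoalgHom ℂ A) ρ z).symm
  have actL_θ (s a b) : LinearMap.mul' ℂ A (actL (θ s) (a ⊗ₜ[ℂ] b)) =
      actL (η s) (a * b) - ∑ t, actL (f s t) a * actL (η t) b - actL (η s) a * b := by
    simp only [θ, tmul, actL_sub, actL_sum, map_sub, map_sum, actL_mul, actL_tmul, actL_counit,
      LinearMap.mul'_apply]
  have actR_θ (s a b) : LinearMap.mul' ℂ A (actR (θ s) (a ⊗ₜ[ℂ] b)) =
      actR (η s) (a * b) - ∑ t, actR (f s t) a * actR (η t) b - actR (η s) a * b := by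
    simp only [θ, tmul, actR_sub, actR_sum, map_sub, map_sum, actR_mul, actR_tmul, actR_counit,
      LinearMap.mul'_apply]
  have actR_η (s a) : actR (η s) a = coboundary Λ η s a + ∑ t, Λ s t * actL (η t) a := by
    rw [coboundary_apply, sub_add_cancel]
  have θ_eq_zero : θ = 0 := hΛ.tensor_functional_eq_zero fun s z => by
    induction z with
    | zero => simp
    | add x y hx hy => simp only [map_add, hx, hy, mul_add, Finset.sum_add_distrib]
    | tmul a b =>
      have h_swap : ∑ t, ∑ u, actR (f s t) a * (Λ t u * actL (η u) b) =
          ∑ t, ∑ u, Λ s t * (actL (f t u) a * actL (η u) b) := by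
        rw [Finset.sum_comm]
        conv_rhs => rw [Finset.sum_comm]
        simp only [← mul_assoc, ← Finset.sum_mul, hf _ _ _]
      simp only [actL_θ, actR_θ, actR_η, hη, mul_add, mul_sub, add_mul, Finset.mul_sum,
        Finset.sum_add_distrib, Finset.sum_sub_distrib, Finset.sum_mul, h_swap, mul_assoc]
      abel
  have h_apply := LinearMap.congr_fun (congrFun θ_eq_zero s) (a ⊗ₜ[ℂ] b)
  rw [← sub_eq_zero, ← sub_sub]
  simpa [θ, tmul] using h_apply

lemma isStructureData_of_mul
    (hf : Intertwines Λ f)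
    (f_one : ∀ s t, f s t 1 = (1 : Matrix I I ℂ) s t)
    (f_mul : ∀ s u a b, f s u (a * b) = ∑ t, f s t a * f t u b)
    (η_mul : ∀ s a b, η s (a * b) = ∑ t, f s t a * η t b + η s a * Coalgebra.counit (R := ℂ) b) :
    IsStructureData Λ f η := by
  have η_one (s) : η s 1 = 0 := by
    simpa [f_one, Matrix.one_apply] using η_mul s 1 1
  let ρ : A →ₗ[ℂ] Matrix (I ⊕ Unit) (I ⊕ Unit) ℂ :=
    { toFun a := Matrix.fromBlocks (Matrix.of fun i j => f i j a) (Matrix.of fun i _ => η i a) 0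
        (Matrix.of fun _ _ => Coalgebra.counit (R := ℂ) a)
      map_add' a b := by ext (i | i) (j | j) <;> simp
      map_smul' z a := by ext (i | i) (j | j) <;> simp }
  refine ⟨hf, AlgHom.ofLinearMap ρ ?_ fun a b => ?_, fun a => rfl⟩
  · ext (i | i) (j | j) <;> simp [ρ, f_one, η_one, Matrix.one_apply]
  · ext (i | i) (j | j) <;> simp [ρ, f_mul, η_mul, Matrix.mul_apply, Bialgebra.counit_mul]

end CoboundaryMul

section Quadratic

open scoped Matrix.Module

variable {A B C I n : Type*} [Ring A] [Ring B] [Ring C] [Fintype n]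

lemma comp_matrix_smul [DecidableEq n] {M N : Type*} [AddCommGroup M] [Module ℂ M]
    [AddCommGroup N] [Module ℂ N] (g : M →ₗ[ℂ] N) (R : Matrix n n ℂ) (v : n → M) :
    g ∘ (R • v) = R • (g ∘ v) :=
  map_smul (g.mapMatrixModule n) R v

lemma smul_matrix_smul [DecidableEq n] {M : Type*} [AddCommGroup M] [Module ℂ M] (z : ℂ)
    (R : Matrix n n ℂ) (v : n → M) : z • R • v = R • z • v :=
  comp_matrix_smul (LinearMap.lsmul ℂ M z) R v

lemma sub_one_smul_half [DecidableEq n] {R : Matrix n n ℂ} {v : n → ℂ}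
    (hv : (R + 1) • v = 0) : (R - 1) • (2⁻¹ : ℂ) • v = -v := by
  rw [add_smul, one_smul, add_eq_zero_iff_eq_neg] at hv
  rw [← smul_matrix_smul, sub_smul, one_smul, hv, ← neg_add', ← two_smul ℂ, smul_neg, smul_smul]
  norm_num

lemma comp_vec_sub {κ M N : Type*} [AddCommGroup M] [Module ℂ M] [AddCommGroup N] [Module ℂ N]
    (g : M →ₗ[ℂ] N) (u v : κ → M) : g ∘ (u - v) = g ∘ u - g ∘ v :=
  map_sub (g.compLeft κ) u v

/-- The coaction `T ↦ w T` on `ℂⁿ` belonging to a matrix `w` over `A`. -/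
def coactVec [Algebra ℂ A] (w : Matrix n n A) : (n → ℂ) →ₗ[ℂ] n → A :=
  Fintype.linearCombination ℂ fun y x => w x y

lemma coactVec_apply [Algebra ℂ A] (w : Matrix n n A) (T : n → ℂ) (x : n) :
    coactVec w T x = ∑ y, T y • w x y := by
  simp [coactVec, Fintype.linearCombination_apply]

lemma coactVec_map [Algebra ℂ A] [Algebra ℂ C] (φ : A →ₐ[ℂ] C) (w : Matrix n n A) (T : n → ℂ) :
    coactVec (w.map φ) T = φ ∘ coactVec w T := by
  ext x
  simp [coactVec_apply]

lemma IsMor.smul_coactVec [DecidableEq n] [Bialgebra ℂ A] {w : Matrix n n A} {M : Matrix n n ℂ}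
    (hM : IsMor w w M) (T : n → ℂ) : M • coactVec w T = coactVec w (M • T) := by
  ext x
  have hM_apply (y) : ∑ k, M x k • w k y = ∑ k, M k y • w x k := by
    simpa [scal, Matrix.mul_apply, Algebra.smul_def, Algebra.commutes] using
      congrFun (congrFun hM x) y
  simp only [Matrix.Module.smul_apply, coactVec_apply, Finset.smul_sum, Finset.sum_smul,
    smul_comm (M x _) (T _), smul_eq_mul, mul_smul]
  rw [Finset.sum_comm]
  simp only [← Finset.smul_sum, hM_apply]
  rw [Finset.sum_comm]
  simp only [Finset.smul_sum, smul_comm (M _ _) (T _)]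

lemma IsMor.sub_one_smul_coactVec [DecidableEq n] [Bialgebra ℂ A] {w : Matrix n n A}
    {M : Matrix n n ℂ} (hM : IsMor w w M) (T : n → ℂ) :
    (M - 1) • coactVec w T = coactVec w ((M - 1) • T) := by
  rw [sub_smul, sub_smul, one_smul, one_smul, map_sub, hM.smul_coactVec]

/-- The matrix `[[w, x], [0, 1]]` has the comultiplication of a representation; tested on the
slices `id ⊗ ρ`. -/
def IsSkewPrimitive [Bialgebra ℂ A] (w : Matrix n n A) (x : n → A) : Prop :=
  ∀ ρ : A →ₗ[ℂ] ℂ, actL ρ ∘ x = coactVec w (ρ ∘ x) + ρ 1 • x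

lemma IsSkewPrimitive.eq_sub_coactVec [Bialgebra ℂ A] {w : Matrix n n A} {x : n → A}
    (hx : IsSkewPrimitive w x) {χ : A →ₗ[ℂ] ℂ} (χ_one : χ 1 = 1)
    (hχ : ∀ a, actL χ a = χ a • (1 : A)) :
    x = algebraMap ℂ A ∘ χ ∘ x - coactVec w (χ ∘ x) := by
  have h_actL := hx χ
  rw [χ_one, one_smul] at h_actL
  rw [eq_sub_iff_add_eq', ← h_actL]
  ext k
  simp [hχ, Algebra.algebraMap_eq_smul_one]

variable [Fintype I] [DecidableEq I]

section Bialg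

variable [Bialgebra ℂ A] {Λ : Matrix I I A} {f : I → I → A →ₗ[ℂ] ℂ} {η : I → A →ₗ[ℂ] ℂ}

lemma rmat_isMor (hΛ : IsRep Λ) (hf : Intertwines Λ f) :
    IsMor (Λ ⊗ₖ Λ) (Λ ⊗ₖ Λ) (Rmat f Λ) := by
  ext k b
  have hf_apply := hf k.1 b.2 (Λ k.2 b.1)
  simp only [hΛ.actL, hΛ.actR, Finset.mul_sum, Finset.sum_mul, mul_smul_comm,
    smul_mul_assoc] at hf_apply
  simp only [scal, Matrix.mul_apply, Matrix.map_apply, Matrix.kroneckerMap_apply,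
    ← Algebra.smul_def, ← Algebra.commutes]
  rw [Fintype.sum_prod_type_right, Fintype.sum_prod_type]
  exact hf_apply.symm

variable [Algebra ℂ C] {φ : A →ₐ[ℂ] C} {q : I → C}

lemma CrossRel.mul_rep (hc : CrossRel φ q Λ f η) (hΛ : IsRep Λ) (b : I) :
    (fun x : I × I => q x.1 * φ (Λ x.2 b)) =
      Rmat f Λ • (fun x : I × I => φ (Λ x.1 b) * q x.2) +
        (fun x => ∑ s, Zmat η Λ x s • φ (Λ s b)) -
        φ ∘ coactVec (Λ ⊗ₖ Λ) (fun y => Zmat η Λ y b) := by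
  ext ⟨i, j⟩
  rw [hc, hΛ.actR]
  simp only [hΛ.actL, hΛ.actR, Finset.mul_sum, Finset.sum_mul, mul_smul_comm,
    smul_mul_assoc, map_sum, map_smul]
  rw [Finset.sum_comm]
  simp [Fintype.sum_prod_type, coactVec_apply, Rmat, Gmat, Zmat, Hmat]

/-- The quadratic elements `q_i q_j - η_i(Λ_js) q_s`. -/
def quadElem (q : I → C) (Λ : Matrix I I A) (η : I → A →ₗ[ℂ] ℂ) : I × I → C :=
  (fun x => q x.1 * q x.2) - fun x => ∑ s, Zmat η Λ x s • q s

lemma quadRel_iff {T : I × I → ℂ} : QuadRel φ q Λ f η T ↔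
    (Rmat f Λ - 1) • (quadElem q Λ η + algebraMap ℂ C ∘ T - φ ∘ coactVec (Λ ⊗ₖ Λ) T) = 0 := by
  rw [funext_iff, Prod.forall]
  simp only [QuadRel, Matrix.Module.smul_apply, quadElem, Zmat, Hmat, coactVec_apply,
    Fintype.sum_prod_type, Pi.sub_apply, Pi.add_apply, Pi.zero_apply, Function.comp_apply,
    Matrix.of_apply, Matrix.kroneckerMap_apply, map_sum, map_smul]

end Bialg

namespace IsInhomogeneous

variable [HopfAlgebra ℂ A] [Bialgebra ℂ B] {Λ : Matrix I I A} {ι : A →ₐc[ℂ] B} {p : I → B}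
  {f : I → I → A →ₗ[ℂ] ℂ} {η : I → A →ₗ[ℂ] ℂ}

lemma actL_gamMap (hB : IsInhomogeneous Λ ι p) (σ : B →ₗ[ℂ] ℂ) (x : (I → A) × A) :
    actL σ (gamMap (ι : A →ₐ[ℂ] B) p x) =
      gamMap (ι : A →ₐ[ℂ] B) p (fun i => actL (σ ∘ₗ (ι : A →ₗ[ℂ] B)) (x.1 i),
        ∑ i, ∑ u, actL ((σ ∘ₗ LinearMap.mulRight ℂ (p u)) ∘ₗ (ι : A →ₗ[ℂ] B)) (x.1 i) * Λ i u +
          actL (σ ∘ₗ (ι : A →ₗ[ℂ] B)) x.2) := by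
  have actL_ι (σ : B →ₗ[ℂ] ℂ) (a : A) :
      actL σ (ι a) = ι (actL (σ ∘ₗ (ι : A →ₗ[ℂ] B)) a) := actL_map (ι : A →ₗc[ℂ] B) σ a
  simp only [gamMap_apply, map_add, map_sum, hB.actL_mul_p, actL_ι, Finset.sum_add_distrib,
    map_mul, BialgHom.coe_toAlgHom]
  abel

section SkewPrimitive

variable {w : Matrix n n A} {x : n → (I → A) × A}

lemma gamMap_isSkewPrimitive (hB : IsInhomogeneous Λ ι p) (hΛ : HomogeneousData Λ)
    (hx : IsSkewPrimitive (w.map ι) fun k => gamMap (ι : A →ₐ[ℂ] B) p (x k)) (σ : B →ₗ[ℂ] ℂ)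
    (k : n) :
    (fun i => actL (σ ∘ₗ (ι : A →ₗ[ℂ] B)) ((x k).1 i),
      ∑ i, ∑ u, actL ((σ ∘ₗ LinearMap.mulRight ℂ (p u)) ∘ₗ (ι : A →ₗ[ℂ] B)) ((x k).1 i) * Λ i u +
        actL (σ ∘ₗ (ι : A →ₗ[ℂ] B)) (x k).2) =
    (σ 1 • (x k).1,
      coactVec w (fun y => σ (gamMap (ι : A →ₐ[ℂ] B) p (x y))) k + σ 1 • (x k).2) := by
  refine hB.gamMap_injective hΛ ?_
  rw [← hB.actL_gamMap]
  refine (congrFun (hx σ) k).trans ?_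
  rw [show w.map ι = w.map (ι : A →ₐ[ℂ] B) from rfl, coactVec_map]
  simp only [BialgHom.coe_toAlgHom, gamMap_apply, Function.comp_def, map_add, map_sum,
    Pi.add_apply, Pi.smul_apply, smul_add, Finset.smul_sum, map_smul, Algebra.smul_mul_assoc]
  abel

lemma fst_eq_zero_of_isSkewPrimitive (hB : IsInhomogeneous Λ ι p) (hΛ : HomogeneousData Λ)
    (hx : IsSkewPrimitive (w.map ι) fun k => gamMap (ι : A →ₐ[ℂ] B) p (x k))
    (hw : ∀ M : Matrix n I ℂ, IsMor Λ w M → M = 0) (k : n) : (x k).1 = 0 := by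
  have fst_eq (k i) : algebraMap ℂ A (Coalgebra.counit (R := ℂ) ((x k).1 i)) = (x k).1 i := by
    refine eq_of_forall_dual fun ρ => ?_
    obtain ⟨σ, rfl⟩ := exists_extend_dual hB.injective ρ
    have h_fst := congrArg (fun z => Coalgebra.counit (R := ℂ) (z.1 i))
      (hB.gamMap_isSkewPrimitive hΛ hx σ k)
    simpa [Algebra.algebraMap_eq_smul_one, mul_comm] using h_fst.symm
  have counit_smul (k i) (a : A) :
      Coalgebra.counit (R := ℂ) ((x k).1 i) • a = a * (x k).1 i := by
    rw [Algebra.smul_def, Algebra.commutes, fst_eq]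
  have hM : IsMor Λ w (Matrix.of fun k i => Coalgebra.counit (R := ℂ) ((x k).1 i)) := by
    ext k r
    obtain ⟨σ, σ_gamMap, σ_ι, σ_mul_p⟩ := exists_fst_dual (hB.gamMap_injective hΛ) r
    have σ_ι : σ ∘ₗ (ι : A →ₗ[ℂ] B) = 0 := σ_ι
    have σ_one : σ 1 = 0 := by simpa using LinearMap.congr_fun σ_ι 1
    have σ_mul_p (u) : (σ ∘ₗ LinearMap.mulRight ℂ (p u)) ∘ₗ (ι : A →ₗ[ℂ] B) =
        (1 : Matrix I I ℂ) r u • Coalgebra.counit := σ_mul_p u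
    have h_snd := congrArg Prod.snd (hB.gamMap_isSkewPrimitive hΛ hx σ k)
    simp only [σ_ι, σ_one, σ_mul_p, σ_gamMap, actL_smul, actL_counit, coactVec_apply] at h_snd
    simpa [scal, Matrix.mul_apply, Matrix.one_apply, fst_eq, counit_smul] using h_snd
  ext i
  have counit_eq_zero : Coalgebra.counit (R := ℂ) ((x k).1 i) = 0 :=
    congrFun (congrFun (hw _ hM) k) i
  rw [← fst_eq, counit_eq_zero, map_zero, Pi.zero_apply]

lemma exists_eq_comp_of_isSkewPrimitive (hB : IsInhomogeneous Λ ι p) (hΛ : HomogeneousData Λ)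
    {V : n → B} (hV : IsSkewPrimitive (w.map ι) V) (hmem : ∀ k, V k ∈ Gam (ι : A →ₐ[ℂ] B) p)
    (hw : ∀ M : Matrix n I ℂ, IsMor Λ w M → M = 0) :
    ∃ c : n → A, IsSkewPrimitive w c ∧ V = ι ∘ c := by
  choose x hx using fun k => (range_gamMap (ι : A →ₐ[ℂ] B) p).ge (hmem k)
  obtain rfl : (fun k => gamMap (ι : A →ₐ[ℂ] B) p (x k)) = V := funext hx
  have fst_eq_zero := hB.fst_eq_zero_of_isSkewPrimitive hΛ hV hw
  have gamMap_eq (k) : gamMap (ι : A →ₐ[ℂ] B) p (x k) = ι (x k).2 := by simp [fst_eq_zero k]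
  refine ⟨fun k => (x k).2, fun ρ => ?_, funext gamMap_eq⟩
  obtain ⟨σ, rfl⟩ := exists_extend_dual hB.injective ρ
  ext k
  have h_snd := congrArg Prod.snd (hB.gamMap_isSkewPrimitive hΛ hV σ k)
  simpa [fst_eq_zero, gamMap_eq, Function.comp_def] using h_snd

end SkewPrimitive

lemma actL_p_mul_p (hB : IsInhomogeneous Λ ι p) (ρ : B →ₗ[ℂ] ℂ) :
    actL ρ ∘ (fun x : I × I => p x.1 * p x.2) =
      coactVec ((Λ ⊗ₖ Λ).map ι) (ρ ∘ fun x => p x.1 * p x.2) +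
        ∑ b, ρ (p b) • (fun x : I × I => p x.1 * ι (Λ x.2 b)) +
        ∑ a, ρ (p a) • (fun x : I × I => ι (Λ x.1 a) * p x.2) +
        ρ 1 • fun x => p x.1 * p x.2 := by
  ext ⟨i, j⟩
  simp only [Function.comp_apply, hB.actL_mul_p, hB.actL_p, LinearMap.comp_apply,
    LinearMap.mulRight_apply, add_mul, Finset.sum_mul, Finset.sum_add_distrib, smul_mul_assoc,
    one_mul, map_mul, Fintype.sum_prod_type_right, add_assoc, coactVec_apply, Pi.add_apply,
    Finset.sum_apply, Pi.smul_apply, Matrix.map_apply, Matrix.kroneckerMap_apply]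

lemma actL_quadElem (hB : IsInhomogeneous Λ ι p) (hΛ : IsRep Λ)
    (hc : CrossRel (ι : A →ₐ[ℂ] B) p Λ f η) (ρ : B →ₗ[ℂ] ℂ) :
    actL ρ ∘ quadElem p Λ η =
      coactVec ((Λ ⊗ₖ Λ).map ι) (ρ ∘ quadElem p Λ η) + ρ 1 • quadElem p Λ η +
        (Rmat f Λ + 1) • ∑ a, ρ (p a) • (fun x : I × I => ι (Λ x.1 a) * p x.2) := by
  have p_mul_ι (b) : (fun x : I × I => p x.1 * ι (Λ x.2 b)) =
      Rmat f Λ • (fun x : I × I => ι (Λ x.1 b) * p x.2) +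
        (fun x => ∑ s, Zmat η Λ x s • ι (Λ s b)) -
        coactVec ((Λ ⊗ₖ Λ).map ι) (fun y => Zmat η Λ y b) :=
    (hc.mul_rep hΛ b).trans (by rw [← coactVec_map]; rfl)
  have actL_linear : actL ρ ∘ (fun x => ∑ s, Zmat η Λ x s • p s) =
      ∑ b, ρ (p b) • (fun x => ∑ s, Zmat η Λ x s • ι (Λ s b)) +
        ρ 1 • fun x => ∑ s, Zmat η Λ x s • p s := by
    ext x
    simp only [Function.comp_apply, map_sum, map_smul, hB.actL_p, smul_add, Finset.smul_sum,
      Finset.sum_add_distrib, smul_comm (Zmat η Λ _ _), Pi.add_apply, Finset.sum_apply,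
      Pi.smul_apply]
    rw [Finset.sum_comm]
  have ρ_linear : ρ ∘ (fun x => ∑ s, Zmat η Λ x s • p s) =
      ∑ b, ρ (p b) • fun x => Zmat η Λ x b := by
    ext x
    simp [mul_comm]
  rw [quadElem, comp_vec_sub, comp_vec_sub, hB.actL_p_mul_p, actL_linear, ρ_linear]
  simp only [p_mul_ι, smul_sub, smul_add, Finset.sum_add_distrib, Finset.sum_sub_distrib,
    map_sub, map_sum, map_smul, add_smul, one_smul, Finset.smul_sum, smul_matrix_smul]
  abel

lemma quadVec_isSkewPrimitive (hB : IsInhomogeneous Λ ι p) (hΛ : IsRep Λ) (hf : Intertwines Λ f)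
    (hR : Rmat f Λ * Rmat f Λ = 1) (hc : CrossRel (ι : A →ₐ[ℂ] B) p Λ f η) :
    IsSkewPrimitive ((Λ ⊗ₖ Λ).map ι) ((Rmat f Λ - 1) • quadElem p Λ η) := fun ρ => by
  have smul_coactVec (T : I × I → ℂ) :
      (Rmat f Λ - 1) • coactVec ((Λ ⊗ₖ Λ).map ι) T =
        coactVec ((Λ ⊗ₖ Λ).map ι) ((Rmat f Λ - 1) • T) := by
    have coactVec_ι (T) : coactVec ((Λ ⊗ₖ Λ).map ι) T = ι ∘ coactVec (Λ ⊗ₖ Λ) T :=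
      coactVec_map (ι : A →ₐ[ℂ] B) _ T
    rw [coactVec_ι, coactVec_ι, ← (rmat_isMor hΛ hf).sub_one_smul_coactVec]
    exact (comp_matrix_smul (ι : A →ₗ[ℂ] B) _ _).symm
  have sub_mul_add : (Rmat f Λ - 1) * (Rmat f Λ + 1) = 0 := by
    rw [sub_mul, mul_add, hR, one_mul, mul_one, add_comm, sub_self]
  rw [comp_matrix_smul, comp_matrix_smul, hB.actL_quadElem hΛ hc, smul_add, smul_add,
    smul_coactVec, smul_smul, sub_mul_add, zero_smul, add_zero, smul_matrix_smul]

lemma quadVec_mem_gam (hmax : IsMaximal (ι : A →ₐ[ℂ] B) p Λ f) (k : I × I) :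
    ((Rmat f Λ - 1) • quadElem p Λ η) k ∈ Gam (ι : A →ₐ[ℂ] B) p := by
  have sub_mul_add : (Rmat f Λ - 1) * (Rmat f Λ + 1) = 0 := by
    rw [sub_mul, mul_add, hmax.1, one_mul, mul_one, add_comm, sub_self]
  have p_mem (s) : p s ∈ Gam (ι : A →ₐ[ℂ] B) p :=
    Submodule.mem_sup_left (Submodule.subset_span ⟨(1, s), by simp⟩)
  have leading_mem := (hmax.2 fun x => (Rmat f Λ - 1) k x).1 (congrFun sub_mul_add k)
  rw [← Fintype.sum_prod_type'] at leading_mem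
  simp only [Matrix.Module.smul_apply, quadElem, Pi.sub_apply, smul_sub, Finset.sum_sub_distrib]
  exact Submodule.sub_mem _ leading_mem (Submodule.sum_mem _ fun x _ => Submodule.smul_mem _ _
    (Submodule.sum_mem _ fun s _ => Submodule.smul_mem _ _ (p_mem s)))

lemma exists_quadRel (hB : IsInhomogeneous Λ ι p) (hΛ : HomogeneousData Λ) (hf : Intertwines Λ f)
    (hmax : IsMaximal (ι : A →ₐ[ℂ] B) p Λ f) (hc : CrossRel (ι : A →ₐ[ℂ] B) p Λ f η) :
    ∃ T : I × I → ℂ, QuadRel (ι : A →ₐ[ℂ] B) p Λ f η T := by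
  have add_mul_sub : (Rmat f Λ + 1) * (Rmat f Λ - 1) = 0 := by
    rw [add_mul, mul_sub, hmax.1, one_mul, mul_one, sub_add_sub_cancel, sub_self]
  obtain ⟨c, c_skew, V_eq⟩ := hB.exists_eq_comp_of_isSkewPrimitive hΛ
    (hB.quadVec_isSkewPrimitive hΛ.isRep hf hmax.1 hc) (quadVec_mem_gam hmax)
    fun M hM => hΛ.mor_irrep_eq_zero hΛ.irreducible hM
  obtain ⟨χ, χ_one, hχ⟩ := exists_haar hΛ.antipode_bijective.1 hΛ.completelyReducible
  have ι_smul (R : Matrix (I × I) (I × I) ℂ) (v : I × I → A) : ι ∘ (R • v) = R • (ι ∘ v) :=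
    comp_matrix_smul (ι : A →ₗ[ℂ] B) R v
  have add_smul_c : (Rmat f Λ + 1) • c = 0 := by
    refine hB.injective.comp_left ((ι_smul _ c).trans ?_)
    rw [← V_eq, smul_smul, add_mul_sub, zero_smul]
    ext
    simp
  have sub_smul_χ : (Rmat f Λ - 1) • (2⁻¹ : ℂ) • (χ ∘ c) = -(χ ∘ c) := by
    refine sub_one_smul_half ?_
    rw [← comp_matrix_smul, add_smul_c]
    ext
    simp
  refine ⟨(2⁻¹ : ℂ) • (χ ∘ c), quadRel_iff.2 ?_⟩
  have c_eq : c = algebraMap ℂ A ∘ χ ∘ c - coactVec (Λ ⊗ₖ Λ) (χ ∘ c) :=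
    c_skew.eq_sub_coactVec χ_one hχ
  have smul_alg : (Rmat f Λ - 1) • (algebraMap ℂ B ∘ ((2⁻¹ : ℂ) • (χ ∘ c))) =
      algebraMap ℂ B ∘ (-(χ ∘ c)) := by
    rw [← sub_smul_χ]
    exact (comp_matrix_smul (Algebra.linearMap ℂ B) _ _).symm
  have smul_coact : (Rmat f Λ - 1) • (ι ∘ coactVec (Λ ⊗ₖ Λ) ((2⁻¹ : ℂ) • (χ ∘ c))) =
      ι ∘ coactVec (Λ ⊗ₖ Λ) (-(χ ∘ c)) := by
    rw [← ι_smul, (rmat_isMor hΛ.isRep hf).sub_one_smul_coactVec, sub_smul_χ]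
  rw [smul_sub, smul_add, V_eq, smul_alg]
  refine (congrArg _ smul_coact).trans (funext fun k => ?_)
  have c_apply := congrArg ι (congrFun c_eq k)
  simp only [Pi.sub_apply, Function.comp_apply, map_sub, AlgHomClass.commutes] at c_apply
  simp only [Pi.add_apply, Pi.sub_apply, Function.comp_apply, c_apply, Pi.neg_apply, map_neg,
    Pi.zero_apply]
  abel

end IsInhomogeneous

end Quadratic

section Filtration

open scoped Matrix.Module

variable {A B C I : Type*} [Ring A] [Ring B] [Ring C] [Algebra ℂ C]

lemma matrix_smul_mem {n M : Type*} [Fintype n] [DecidableEq n] [AddCommGroup M] [Module ℂ M]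
    {W : Submodule ℂ M} {v : n → M} (hv : ∀ x, v x ∈ W) (R : Matrix n n ℂ) (k : n) :
    (R • v) k ∈ W := by
  rw [Matrix.Module.smul_apply]
  exact Submodule.sum_mem _ fun x _ => Submodule.smul_mem _ _ (hv x)

lemma IsRep.mem_of_sum_mul_mem {n : Type*} [Fintype n] [DecidableEq n] [HopfAlgebra ℂ A]
    {φ : A →ₐ[ℂ] C} {w : Matrix n n A} (hw : IsRep w) {W : Submodule ℂ C}
    (hW : ∀ x ∈ W, ∀ a, x * φ a ∈ W) {y : n → C} (hy : ∀ j, ∑ t, y t * φ (w t j) ∈ W) (s : n) :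
    y s ∈ W := by
  have y_eq : Matrix.vecMul (Matrix.vecMul y (w.map φ))
      ((w.map (HopfAlgebra.antipode ℂ)).map φ) = y := by
    rw [Matrix.vecMul_vecMul, ← Matrix.map_mul, hw.mul_map_antipode,
      Matrix.map_one _ (map_zero φ) (map_one φ), Matrix.vecMul_one]
  rw [← congrFun y_eq s]
  exact Submodule.sum_mem _ fun j _ => hW _ (hy j) _

section General

variable [Bialgebra ℂ A] (φ : A →ₐ[ℂ] C) (q : I → C)

/-- The filtration by degree in the `q_i`. The index is shifted by one: `fil φ q (n + 1)` consists
of the elements of degree at most `n`. -/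
def fil : ℕ → Submodule ℂ C
  | 0 => ⊥
  | n + 1 => LinearMap.range φ.toLinearMap ⊔ ⨆ i, (fil n).map (LinearMap.mulRight ℂ (q i))

variable {φ q}

lemma mem_fil_zero {x : C} : x ∈ fil φ q 0 ↔ x = 0 := Submodule.mem_bot ℂ

lemma fil_succ_le_iff {n : ℕ} {W : Submodule ℂ C} : fil φ q (n + 1) ≤ W ↔
    (∀ a, φ a ∈ W) ∧ ∀ x ∈ fil φ q n, ∀ i, x * q i ∈ W := by
  simp only [fil, sup_le_iff, iSup_le_iff, Submodule.map_le_iff_le_comap]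
  exact and_congr ⟨fun h a => h ⟨a, rfl⟩, by rintro h _ ⟨a, rfl⟩; exact h a⟩
    ⟨fun h x hx i => h i hx, fun h i x hx => h x hx i⟩

lemma map_mem_fil (n : ℕ) (a : A) : φ a ∈ fil φ q (n + 1) := (fil_succ_le_iff.1 le_rfl).1 a

lemma mul_mem_fil {n : ℕ} {x : C} (hx : x ∈ fil φ q n) (i : I) : x * q i ∈ fil φ q (n + 1) :=
  (fil_succ_le_iff.1 le_rfl).2 x hx i

lemma mul_mem_fil_of_pred {n : ℕ} {x : C} (hx : x ∈ fil φ q (n - 1)) (i : I) :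
    x * q i ∈ fil φ q n := by
  cases n with
  | zero =>
    rw [mem_fil_zero.1 hx, zero_mul]
    exact Submodule.zero_mem _
  | succ n => exact mul_mem_fil hx i

lemma exists_of_mem_fil_succ [Fintype I] {n : ℕ} {x : C} (hx : x ∈ fil φ q (n + 1)) :
    ∃ (a : A) (y : I → C), (∀ i, y i ∈ fil φ q n) ∧ x = φ a + ∑ i, y i * q i := by
  obtain ⟨_, ⟨a, rfl⟩, _, h, rfl⟩ := Submodule.mem_sup.1 hx
  obtain ⟨z, hz, rfl⟩ := (Submodule.mem_iSup_iff_exists_finsupp _ _).1 h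
  choose y hy hyz using hz
  refine ⟨a, y, hy, ?_⟩
  rw [Finsupp.sum_fintype _ _ fun _ => rfl]
  exact congrArg _ (Finset.sum_congr rfl fun i _ => (hyz i).symm)

lemma fil_le_succ (n : ℕ) : fil φ q n ≤ fil φ q (n + 1) := by
  induction n with
  | zero => exact bot_le
  | succ n ih =>
    exact fil_succ_le_iff.2 ⟨map_mem_fil _, fun x hx i => mul_mem_fil (ih hx) i⟩

lemma fil_mono : Monotone (fil φ q) := monotone_nat_of_le_succ fil_le_succ

lemma map_fil {D : Type*} [Ring D] [Algebra ℂ D] {φ' : A →ₐ[ℂ] D} {q' : I → D}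
    (π : C →ₐ[ℂ] D) (hφ : ∀ a, π (φ a) = φ' a) (hq : ∀ i, π (q i) = q' i) (n : ℕ) :
    fil φ q n ≤ (fil φ' q' n).comap π.toLinearMap := by
  induction n with
  | zero => exact bot_le
  | succ n ih =>
    refine fil_succ_le_iff.2 ⟨fun a => ?_, fun x hx i => ?_⟩
    · rw [Submodule.mem_comap, AlgHom.toLinearMap_apply, hφ]
      exact map_mem_fil n a
    · rw [Submodule.mem_comap, AlgHom.toLinearMap_apply, map_mul, hq]
      exact mul_mem_fil (ih hx) i

variable [Fintype I] {Λ : Matrix I I A} {f : I → I → A →ₗ[ℂ] ℂ} {η : I → A →ₗ[ℂ] ℂ}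
  {T : I × I → ℂ}

lemma CrossRel.mul_map_mem_fil (hc : CrossRel φ q Λ f η) {n : ℕ} {x : C} (hx : x ∈ fil φ q n)
    (a : A) : x * φ a ∈ fil φ q n := by
  suffices h : fil φ q n ≤ (fil φ q n).comap (LinearMap.mulRight ℂ (φ a)) from h hx
  clear hx
  induction n generalizing a with
  | zero => exact bot_le
  | succ n ih =>
    refine fil_succ_le_iff.2 ⟨fun b => ?_, fun x hx i => ?_⟩
    · rw [Submodule.mem_comap, LinearMap.mulRight_apply, ← map_mul]
      exact map_mem_fil n (b * a)
    · rw [Submodule.mem_comap, LinearMap.mulRight_apply, mul_assoc, hc, mul_sub,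
        mul_add, Finset.mul_sum, Finset.mul_sum]
      refine Submodule.sub_mem _ (Submodule.add_mem _ (Submodule.sum_mem _ fun t _ => ?_)
        (fil_le_succ _ (ih _ hx))) (Submodule.sum_mem _ fun t _ => fil_le_succ _ (ih _ hx))
      rw [← mul_assoc]
      exact mul_mem_fil (ih _ hx) t

lemma CrossRel.exists_mem_fil (hc : CrossRel φ q Λ f η) {x : C}
    (hx : x ∈ Algebra.adjoin ℂ (Set.range φ ∪ Set.range q)) : ∃ n, x ∈ fil φ q n := by
  suffices ∀ n, ∀ y ∈ fil φ q n, ∃ m, y * x ∈ fil φ q m by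
    obtain ⟨m, hm⟩ := this 1 1 (map_one φ ▸ map_mem_fil 0 1)
    exact ⟨m, one_mul x ▸ hm⟩
  induction hx using Algebra.adjoin_induction with
  | mem x hx =>
    rcases hx with ⟨a, rfl⟩ | ⟨i, rfl⟩
    · exact fun n y hy => ⟨n, hc.mul_map_mem_fil hy a⟩
    · exact fun n y hy => ⟨n + 1, mul_mem_fil hy i⟩
  | algebraMap r =>
    intro n y hy
    exact ⟨n, φ.commutes r ▸ hc.mul_map_mem_fil hy _⟩
  | add u v _ _ hu hv =>
    intro n y hy
    obtain ⟨m, hm⟩ := hu n y hy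
    obtain ⟨m', hm'⟩ := hv n y hy
    exact ⟨max m m', mul_add y u v ▸ Submodule.add_mem _ (fil_mono (le_max_left _ _) hm)
      (fil_mono (le_max_right _ _) hm')⟩
  | mul u v _ _ hu hv =>
    intro n y hy
    obtain ⟨m, hm⟩ := hu n y hy
    obtain ⟨m', hm'⟩ := hv m _ hm
    exact ⟨m', mul_assoc y u v ▸ hm'⟩

variable [DecidableEq I]

lemma QuadRel.sub_one_smul_mem_fil (hq : QuadRel φ q Λ f η T) (hc : CrossRel φ q Λ f η) {n : ℕ}
    {y : C} (hy : y ∈ fil φ q n) (k : I × I) :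
    ((Rmat f Λ - 1) • fun x : I × I => y * q x.1 * q x.2) k ∈ fil φ q (n + 1) := by
  set lower : I × I → C := (fun x => ∑ s, Zmat η Λ x s • q s) - algebraMap ℂ C ∘ T +
    φ ∘ coactVec (Λ ⊗ₖ Λ) T with lower_def
  have smul_eq : (Rmat f Λ - 1) • (fun x : I × I => q x.1 * q x.2) = (Rmat f Λ - 1) • lower := by
    rw [← sub_eq_zero, ← smul_sub, ← quadRel_iff.1 hq, quadElem, lower_def]
    congr 1
    abel
  have mul_smul_eq : (Rmat f Λ - 1) • (fun x : I × I => y * q x.1 * q x.2) =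
      (Rmat f Λ - 1) • (LinearMap.mulLeft ℂ y ∘ lower) := by
    rw [← comp_matrix_smul, ← smul_eq, comp_matrix_smul]
    congr 1
    ext x
    simp [mul_assoc]
  rw [mul_smul_eq]
  refine matrix_smul_mem (fun x => ?_) _ k
  have y_smul (z : ℂ) : y * algebraMap ℂ C z ∈ fil φ q (n + 1) :=
    fil_le_succ _ (φ.commutes z ▸ hc.mul_map_mem_fil hy _)
  simp only [lower_def, Function.comp_apply, Pi.add_apply, Pi.sub_apply, LinearMap.mulLeft_apply,
    mul_add, mul_sub, Finset.mul_sum, mul_smul_comm]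
  exact Submodule.add_mem _ (Submodule.sub_mem _ (Submodule.sum_mem _ fun s _ =>
    Submodule.smul_mem _ _ (mul_mem_fil hy s)) (y_smul _))
    (fil_le_succ _ (hc.mul_map_mem_fil hy _))

lemma CrossRel.swap_mem_fil (hc : CrossRel φ q Λ f η) (hΛ : IsRep Λ)
    (hR : Rmat f Λ * Rmat f Λ = 1) {n : ℕ} {y : C} (hy : y ∈ fil φ q n) (k : I × I) (j : I) :
    y * φ (Λ k.1 j) * q k.2 - (Rmat f Λ • fun x : I × I => y * q x.1 * φ (Λ x.2 j)) k ∈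
      fil φ q n := by
  let lower (x : I × I) : A :=
    ∑ s, Zmat η Λ x s • Λ s j - coactVec (Λ ⊗ₖ Λ) (fun z => Zmat η Λ z j) x
  have smul_eq : Rmat f Λ • (fun x : I × I => q x.1 * φ (Λ x.2 j)) =
      (fun x : I × I => φ (Λ x.1 j) * q x.2) + Rmat f Λ • (φ ∘ lower) := by
    rw [hc.mul_rep hΛ, add_sub_assoc, smul_add, smul_smul, hR, one_smul]
    congr 2
    ext x
    simp [lower]
  have mul_smul_apply (v : I × I → C) :
      y * (Rmat f Λ • v) k = (Rmat f Λ • (LinearMap.mulLeft ℂ y ∘ v)) k :=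
    congrFun (comp_matrix_smul (LinearMap.mulLeft ℂ y) (Rmat f Λ) v) k
  have sub_eq : y * φ (Λ k.1 j) * q k.2 -
      (Rmat f Λ • fun x : I × I => y * q x.1 * φ (Λ x.2 j)) k =
      -(Rmat f Λ • (LinearMap.mulLeft ℂ y ∘ φ ∘ lower)) k := by
    have mul_eq : y * (Rmat f Λ • fun x : I × I => q x.1 * φ (Λ x.2 j)) k =
        y * (φ (Λ k.1 j) * q k.2) + y * (Rmat f Λ • (φ ∘ lower)) k := by
      rw [smul_eq, Pi.add_apply, mul_add]
    rw [mul_smul_apply, mul_smul_apply] at mul_eq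
    simp only [mul_assoc]
    exact sub_eq_iff_eq_add'.2 (eq_add_neg_of_add_eq mul_eq.symm)
  exact sub_eq ▸ Submodule.neg_mem _ (matrix_smul_mem (fun x => hc.mul_map_mem_fil hy _) _ k)

end General

section DualFamily

variable [DecidableEq I] {p : I → B}

/-- Functionals `γ_j` on `B` which vanish on `A` and pick out the coefficient of `p_j` in `A p_u`.
The operators `x ↦ γ_j * x` play the role of the partial derivatives. -/
structure IsDualFamily [Bialgebra ℂ A] [Algebra ℂ B] (φ : A →ₐ[ℂ] B) (p : I → B)
    (γ : I → B →ₗ[ℂ] ℂ) : Prop where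
  comp_eq_zero : ∀ j, γ j ∘ₗ φ.toLinearMap = 0
  comp_mulRight : ∀ j u, (γ j ∘ₗ LinearMap.mulRight ℂ (p u)) ∘ₗ φ.toLinearMap =
    (1 : Matrix I I ℂ) j u • Coalgebra.counit

lemma IsDualFamily.actL_map_eq_zero [Bialgebra ℂ A] [Bialgebra ℂ B] {ι : A →ₐc[ℂ] B}
    {φ : A →ₐ[ℂ] C} {π : C →ₐ[ℂ] B} {γ : I → B →ₗ[ℂ] ℂ}
    (hγ : IsDualFamily (ι : A →ₐ[ℂ] B) p γ) (hφ : ∀ a, π (φ a) = ι a) (j : I) (a : A) :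
    actL (γ j) (π (φ a)) = 0 := by
  have actL_ι : actL (γ j) (ι a) = ι (actL (0 : A →ₗ[ℂ] ℂ) a) :=
    hγ.comp_eq_zero j ▸ actL_map (ι : A →ₗc[ℂ] B) (γ j) a
  rw [hφ, actL_ι, actL_zero, map_zero]

variable [Fintype I] [Bialgebra ℂ B] {Λ : Matrix I I A}

namespace IsInhomogeneous

lemma exists_isDualFamily [HopfAlgebra ℂ A] {ι : A →ₐc[ℂ] B} (hB : IsInhomogeneous Λ ι p)
    (hΛ : HomogeneousData Λ) : ∃ γ, IsDualFamily (ι : A →ₐ[ℂ] B) p γ := by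
  choose γ _ γ_ι γ_mul using exists_fst_dual (hB.gamMap_injective hΛ)
  exact ⟨γ, γ_ι, γ_mul⟩

variable [Bialgebra ℂ A] {ι : A →ₐc[ℂ] B} {f : I → I → A →ₗ[ℂ] ℂ} {η : I → A →ₗ[ℂ] ℂ}

lemma actL_mem_fil (hB : IsInhomogeneous Λ ι p) (hc : CrossRel (ι : A →ₐ[ℂ] B) p Λ f η) {n : ℕ}
    (ρ : B →ₗ[ℂ] ℂ) {x : B} (hx : x ∈ fil (ι : A →ₐ[ℂ] B) p n) :
    actL ρ x ∈ fil (ι : A →ₐ[ℂ] B) p n := by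
  suffices h : fil (ι : A →ₐ[ℂ] B) p n ≤ (fil (ι : A →ₐ[ℂ] B) p n).comap (actL ρ) from h hx
  clear hx
  induction n generalizing ρ with
  | zero => exact bot_le
  | succ n ih =>
    refine fil_succ_le_iff.2 ⟨fun a => ?_, fun x hx i => ?_⟩
    · rw [Submodule.mem_comap]
      exact actL_map (ι : A →ₗc[ℂ] B) ρ a ▸ map_mem_fil n _
    · rw [Submodule.mem_comap, hB.actL_mul_p]
      exact Submodule.add_mem _ (Submodule.sum_mem _ fun u _ =>
        fil_le_succ _ (hc.mul_map_mem_fil (ih _ hx) _)) (mul_mem_fil (ih _ hx) i)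

lemma actL_sub_smul_mem_fil (hB : IsInhomogeneous Λ ι p)
    (hc : CrossRel (ι : A →ₐ[ℂ] B) p Λ f η) {n : ℕ} {ρ : B →ₗ[ℂ] ℂ} {z : ℂ}
    (hρ : ρ ∘ₗ (ι : A →ₐ[ℂ] B).toLinearMap = z • Coalgebra.counit) {x : B}
    (hx : x ∈ fil (ι : A →ₐ[ℂ] B) p (n + 1)) :
    actL ρ x - z • x ∈ fil (ι : A →ₐ[ℂ] B) p n := by
  set D : B →ₗ[ℂ] B := actL ρ - z • LinearMap.id with D_def
  have D_ι (a : A) : D ((ι : A →ₐ[ℂ] B) a) = 0 := by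
    have actL_ι : actL ρ (ι a) = ι (actL (z • (Coalgebra.counit : A →ₗ[ℂ] ℂ)) a) :=
      hρ ▸ actL_map (ι : A →ₗc[ℂ] B) ρ a
    rw [D_def, LinearMap.sub_apply, LinearMap.smul_apply, LinearMap.id_apply,
      BialgHom.coe_toAlgHom, actL_ι, actL_smul, actL_counit, map_smul, sub_self]
  suffices h : fil (ι : A →ₐ[ℂ] B) p (n + 1) ≤
      (fil (ι : A →ₐ[ℂ] B) p n).comap D from h hx
  clear hx
  have D_ι_mem (m : ℕ) (a : A) :
      (ι : A →ₐ[ℂ] B) a ∈ (fil (ι : A →ₐ[ℂ] B) p m).comap D := by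
    rw [Submodule.mem_comap, D_ι]
    exact Submodule.zero_mem _
  induction n with
  | zero =>
    refine fil_succ_le_iff.2 ⟨D_ι_mem 0, fun x hx i => ?_⟩
    rw [mem_fil_zero.1 hx, zero_mul]
    exact Submodule.zero_mem _
  | succ n ih =>
    refine fil_succ_le_iff.2 ⟨D_ι_mem (n + 1), fun x hx i => ?_⟩
    have D_mul : D (x * p i) =
        ∑ u, actL (ρ ∘ₗ LinearMap.mulRight ℂ (p u)) x * ι (Λ i u) + D x * p i := by
      simp only [D_def, LinearMap.sub_apply, LinearMap.smul_apply, LinearMap.id_apply,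
        hB.actL_mul_p, sub_mul, smul_mul_assoc, add_sub_assoc]
    rw [Submodule.mem_comap, D_mul]
    exact Submodule.add_mem _ (Submodule.sum_mem _ fun u _ =>
      hc.mul_map_mem_fil (hB.actL_mem_fil hc _ hx) _) (mul_mem_fil (ih hx) i)

lemma actL_mul_p_sub_mem_fil (hB : IsInhomogeneous Λ ι p)
    (hc : CrossRel (ι : A →ₐ[ℂ] B) p Λ f η) {γ : I → B →ₗ[ℂ] ℂ}
    (hγ : IsDualFamily (ι : A →ₐ[ℂ] B) p γ) {n : ℕ} {x : B}
    (hx : x ∈ fil (ι : A →ₐ[ℂ] B) p (n + 1)) (i j : I) :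
    actL (γ j) (x * p i) - (actL (γ j) x * p i + x * ι (Λ i j)) ∈ fil (ι : A →ₐ[ℂ] B) p n := by
  have sum_one : ∑ u, (1 : Matrix I I ℂ) j u • (x * ι (Λ i u)) = x * ι (Λ i j) := by
    simp [Matrix.one_apply]
  have sub_eq : actL (γ j) (x * p i) - (actL (γ j) x * p i + x * ι (Λ i j)) =
      ∑ u, (actL (γ j ∘ₗ LinearMap.mulRight ℂ (p u)) x - (1 : Matrix I I ℂ) j u • x) *
        ι (Λ i u) := by
    simp only [hB.actL_mul_p, sub_mul, Finset.sum_sub_distrib, smul_mul_assoc, sum_one]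
    abel
  exact sub_eq ▸ Submodule.sum_mem _ fun u _ =>
    hc.mul_map_mem_fil (hB.actL_sub_smul_mem_fil hc (hγ.comp_mulRight j u) hx) _

end IsInhomogeneous

end DualFamily

section Euler

variable [Fintype I] {p : I → B} {q : I → C}

/-- The vector of formal partial derivatives of `∑ e_i q_i` when `y (k, i)` is the `k`-th partial
derivative of `e_i`: the product rule, with `R` moving the differential of `e_i` past `q_i`. -/
def productRule (R : Matrix (I × I) (I × I) ℂ) (q : I → C) (y : I × I → C) (e : I → C) (t : I) :
    C :=
  e t + ∑ k, ∑ c, R k (c, t) • (y k * q c)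

lemma map_productRule [Algebra ℂ B] {π : C →ₐ[ℂ] B} (hq : ∀ i, π (q i) = p i)
    (R : Matrix (I × I) (I × I) ℂ) (y : I × I → C) (e : I → C) (t : I) :
    π (productRule R q y e t) = productRule R p (π ∘ y) (π ∘ e) t := by
  simp [productRule, hq]

lemma sum_productRule_mul [DecidableEq I] (R : Matrix (I × I) (I × I) ℂ) (q : I → C) (y : I × I → C)
    (e z : I → C) :
    ∑ t, productRule R q y e t * z t =
      ∑ t, e t * z t + ∑ k, (R • fun x : I × I => y k * q x.1 * z x.2) k := by
  simp only [productRule, add_mul, Finset.sum_add_distrib, Finset.sum_mul, smul_mul_assoc,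
    Matrix.Module.smul_apply, Fintype.sum_prod_type_right (f := fun x : I × I => R _ x • _)]
  rw [Finset.sum_comm]

variable [Bialgebra ℂ A] {Λ : Matrix I I A} {f : I → I → A →ₗ[ℂ] ℂ}
  {η : I → A →ₗ[ℂ] ℂ} {T : I × I → ℂ}

lemma productRule_mem_fil {φ : A →ₐ[ℂ] C} {n : ℕ} {y : I × I → C} (hy : ∀ k, y k ∈ fil φ q n)
    {e : I → C} (he : ∀ t, e t ∈ fil φ q (n + 1)) (R : Matrix (I × I) (I × I) ℂ) (t : I) :
    productRule R q y e t ∈ fil φ q (n + 1) :=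
  Submodule.add_mem _ (he t) (Submodule.sum_mem _ fun k _ => Submodule.sum_mem _ fun c _ =>
    Submodule.smul_mem _ _ (mul_mem_fil (hy k) c))

/-- `y` is, up to lower degree, the gradient of `d ∈ fil φ q (n + 1)`: Euler's identity
`∑ y_t q_t = n d` holds in `C`, and `γ_j * π(d) = ∑ π(y_t) Λ_tj` holds in `B`. -/
structure IsGradient [Bialgebra ℂ B] (φ : A →ₐ[ℂ] C) (q : I → C) (ι : A →ₐ[ℂ] B) (p : I → B)
    (π : C →ₐ[ℂ] B) (Λ : Matrix I I A) (γ : I → B →ₗ[ℂ] ℂ) (n : ℕ) (d : C) (y : I → C) :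
    Prop where
  mem_fil : ∀ t, y t ∈ fil φ q n
  euler : ∑ t, y t * q t - (n : ℂ) • d ∈ fil φ q n
  actL_map : ∀ j, actL (γ j) (π d) - ∑ t, π (y t) * ι (Λ t j) ∈ fil ι p (n - 1)

variable [DecidableEq I] [Bialgebra ℂ B] {ι : A →ₐc[ℂ] B} {φ : A →ₐ[ℂ] C} {π : C →ₐ[ℂ] B}
  {γ : I → B →ₗ[ℂ] ℂ}

lemma IsDualFamily.isGradient_zero (hγ : IsDualFamily (ι : A →ₐ[ℂ] B) p γ)
    (hφ : ∀ a, π (φ a) = ι a) {d : C} (hd : d ∈ fil φ q 1) :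
    IsGradient φ q (ι : A →ₐ[ℂ] B) p π Λ γ 0 d 0 where
  mem_fil _ := Submodule.zero_mem _
  euler := by simp
  actL_map j := by
    suffices h : fil φ q 1 ≤ LinearMap.ker (actL (γ j) ∘ₗ π.toLinearMap) by
      have actL_d : actL (γ j) (π d) = 0 := h hd
      simp [actL_d]
    refine fil_succ_le_iff.2 ⟨fun a => hγ.actL_map_eq_zero hφ j a, fun x hx i => ?_⟩
    rw [mem_fil_zero.1 hx, zero_mul]
    exact Submodule.zero_mem _

lemma IsGradient.euler_succ {n : ℕ} (hc : CrossRel φ q Λ f η) (hq : QuadRel φ q Λ f η T)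
    {e : I → C} {y : I × I → C}
    (hy : ∀ i, IsGradient φ q (ι : A →ₐ[ℂ] B) p π Λ γ n (e i) fun k => y (k, i)) (a : A) :
    ∑ t, productRule (Rmat f Λ) q y e t * q t - ((n + 1 : ℕ) : ℂ) • (φ a + ∑ i, e i * q i) ∈
      fil φ q (n + 1) := by
  have sub_eq : ∑ t, productRule (Rmat f Λ) q y e t * q t -
      ((n + 1 : ℕ) : ℂ) • (φ a + ∑ i, e i * q i) =
      ∑ k, ((Rmat f Λ - 1) • fun x : I × I => y k * q x.1 * q x.2) k +
        ∑ i, (∑ k, y (k, i) * q k - (n : ℂ) • e i) * q i - ((n + 1 : ℕ) : ℂ) • φ a := by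
    simp only [sum_productRule_mul, sub_smul, one_smul, Pi.sub_apply, Finset.sum_sub_distrib,
      sub_mul, Finset.sum_mul, smul_mul_assoc, Nat.cast_add, Nat.cast_one, add_smul, smul_add,
      Finset.smul_sum, Finset.sum_add_distrib,
      Fintype.sum_prod_type_right (f := fun x : I × I => y x * q x.1 * q x.2)]
    abel
  exact sub_eq ▸ Submodule.sub_mem _ (Submodule.add_mem _
    (Submodule.sum_mem _ fun k _ => hq.sub_one_smul_mem_fil hc ((hy k.2).mem_fil k.1) k)
    (Submodule.sum_mem _ fun i _ => mul_mem_fil (hy i).euler i))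
    (Submodule.smul_mem _ _ (map_mem_fil n a))

lemma IsGradient.actL_map_succ (hB : IsInhomogeneous Λ ι p) (hΛ : IsRep Λ)
    (hR : Rmat f Λ * Rmat f Λ = 1) (hcB : CrossRel (ι : A →ₐ[ℂ] B) p Λ f η)
    (hφ : ∀ a, π (φ a) = ι a) (hπq : ∀ i, π (q i) = p i)
    (hγ : IsDualFamily (ι : A →ₐ[ℂ] B) p γ) {n : ℕ} {e : I → C}
    (he : ∀ i, e i ∈ fil φ q (n + 1)) {y : I × I → C}
    (hy : ∀ i, IsGradient φ q (ι : A →ₐ[ℂ] B) p π Λ γ n (e i) fun k => y (k, i)) (a : A) (j : I) :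
    actL (γ j) (π (φ a + ∑ i, e i * q i)) -
      ∑ t, π (productRule (Rmat f Λ) q y e t) * ι (Λ t j) ∈ fil (ι : A →ₐ[ℂ] B) p n := by
  have π_mem {m : ℕ} {x : C} (hx : x ∈ fil φ q m) : π x ∈ fil (ι : A →ₐ[ℂ] B) p m :=
    map_fil π hφ hπq m hx
  have sub_eq : actL (γ j) (π (φ a + ∑ i, e i * q i)) -
      ∑ t, π (productRule (Rmat f Λ) q y e t) * ι (Λ t j) =
      ∑ i, (actL (γ j) (π (e i) * p i) -
        (actL (γ j) (π (e i)) * p i + π (e i) * ι (Λ i j))) +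
      ∑ i, (actL (γ j) (π (e i)) - ∑ k, π (y (k, i)) * ι (Λ k j)) * p i +
      ∑ k : I × I, (π (y k) * ι (Λ k.1 j) * p k.2 -
        (Rmat f Λ • fun x : I × I => π (y k) * p x.1 * ι (Λ x.2 j)) k) := by
    simp only [map_productRule hπq, sum_productRule_mul, map_add, hγ.actL_map_eq_zero hφ, map_sum,
      map_mul, hπq, Finset.sum_sub_distrib, sub_mul, Finset.sum_mul, Finset.sum_add_distrib,
      Fintype.sum_prod_type_right (f := fun k : I × I => π (y k) * ι (Λ k.1 j) * p k.2),
      Function.comp_apply]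
    abel
  exact sub_eq ▸ Submodule.add_mem _ (Submodule.add_mem _
    (Submodule.sum_mem _ fun i _ => hB.actL_mul_p_sub_mem_fil hcB hγ (π_mem (he i)) i j)
    (Submodule.sum_mem _ fun i _ => mul_mem_fil_of_pred ((hy i).actL_map j) i))
    (Submodule.sum_mem _ fun k _ => hcB.swap_mem_fil hΛ hR (π_mem ((hy k.2).mem_fil k.1)) k j)

lemma exists_isGradient (hB : IsInhomogeneous Λ ι p) (hΛ : IsRep Λ)
    (hR : Rmat f Λ * Rmat f Λ = 1) (hcB : CrossRel (ι : A →ₐ[ℂ] B) p Λ f η)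
    (hc : CrossRel φ q Λ f η) (hq : QuadRel φ q Λ f η T)
    (hφ : ∀ a, π (φ a) = ι a) (hπq : ∀ i, π (q i) = p i)
    (hγ : IsDualFamily (ι : A →ₐ[ℂ] B) p γ) (n : ℕ) {d : C} (hd : d ∈ fil φ q (n + 1)) :
    ∃ y, IsGradient φ q (ι : A →ₐ[ℂ] B) p π Λ γ n d y := by
  induction n generalizing d with
  | zero => exact ⟨0, hγ.isGradient_zero hφ hd⟩
  | succ n ih =>
    obtain ⟨a, e, he, rfl⟩ := exists_of_mem_fil_succ hd
    choose y hy using fun i => ih (he i)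
    exact ⟨productRule (Rmat f Λ) q (fun k => y k.2 k.1) e,
      productRule_mem_fil (fun k => (hy k.2).mem_fil k.1) he _, IsGradient.euler_succ hc hq hy a,
      IsGradient.actL_map_succ hB hΛ hR hcB hφ hπq hγ he hy a⟩

end Euler

section Strict

variable [Fintype I] [DecidableEq I] [HopfAlgebra ℂ A] [Bialgebra ℂ B] {Λ : Matrix I I A}
  {ι : A →ₐc[ℂ] B} {p : I → B} {f : I → I → A →ₗ[ℂ] ℂ} {η : I → A →ₗ[ℂ] ℂ} {T : I × I → ℂ}
  {φ : A →ₐ[ℂ] C} {q : I → C} {π : C →ₐ[ℂ] B}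

lemma IsInhomogeneous.mem_fil_of_map_mem_fil (hB : IsInhomogeneous Λ ι p) (hΛ : HomogeneousData Λ)
    (hR : Rmat f Λ * Rmat f Λ = 1) (hcB : CrossRel (ι : A →ₐ[ℂ] B) p Λ f η)
    (hc : CrossRel φ q Λ f η) (hq : QuadRel φ q Λ f η T)
    (hφ : ∀ a, π (φ a) = ι a) (hπq : ∀ i, π (q i) = p i) (n : ℕ) {d : C}
    (hd : d ∈ fil φ q (n + 1)) (hπd : π d ∈ fil (ι : A →ₐ[ℂ] B) p n) : d ∈ fil φ q n := by
  obtain ⟨γ, hγ⟩ := hB.exists_isDualFamily hΛ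
  induction n generalizing d with
  | zero =>
    obtain ⟨a, y, hy, rfl⟩ := exists_of_mem_fil_succ hd
    have y_eq (i) : y i = 0 := mem_fil_zero.1 (hy i)
    have ι_a : ι a = 0 := by simpa [y_eq, hφ] using mem_fil_zero.1 hπd
    simp [y_eq, (map_eq_zero_iff ι hB.injective).1 ι_a]
  | succ n ih =>
    obtain ⟨y, hy⟩ := exists_isGradient hB hΛ.isRep hR hcB hc hq hφ hπq hγ (n + 1) hd
    have sum_mem (j) : ∑ t, π (y t) * ι (Λ t j) ∈ fil (ι : A →ₐ[ℂ] B) p n := by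
      have actL_mem := hB.actL_sub_smul_mem_fil hcB (z := 0)
        ((hγ.comp_eq_zero j).trans (zero_smul _ _).symm) hπd
      rw [zero_smul, sub_zero] at actL_mem
      exact (Submodule.sub_mem_iff_right _ actL_mem).1 (hy.actL_map j)
    have y_mem (s) : y s ∈ fil φ q n :=
      ih (hy.mem_fil s) (hΛ.isRep.mem_of_sum_mul_mem (fun _ => hcB.mul_map_mem_fil) sum_mem s)
    have sum_mem_C : ∑ t, y t * q t ∈ fil φ q (n + 1) :=
      Submodule.sum_mem _ fun t _ => mul_mem_fil (y_mem t) t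
    exact (Submodule.smul_mem_iff _ (Nat.cast_ne_zero.2 n.succ_ne_zero)).1
      ((Submodule.sub_mem_iff_right _ sum_mem_C).1 hy.euler)

lemma IsInhomogeneous.eq_zero_of_map_eq_zero (hB : IsInhomogeneous Λ ι p) (hΛ : HomogeneousData Λ)
    (hR : Rmat f Λ * Rmat f Λ = 1) (hcB : CrossRel (ι : A →ₐ[ℂ] B) p Λ f η)
    (hc : CrossRel φ q Λ f η) (hq : QuadRel φ q Λ f η T)
    (hφ : ∀ a, π (φ a) = ι a) (hπq : ∀ i, π (q i) = p i) {d : C}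
    (hd : d ∈ Algebra.adjoin ℂ (Set.range φ ∪ Set.range q)) (hπd : π d = 0) : d = 0 := by
  obtain ⟨n, hn⟩ := hc.exists_mem_fil hd
  induction n with
  | zero => exact mem_fil_zero.1 hn
  | succ n ih =>
    exact ih (hB.mem_fil_of_map_mem_fil hΛ hR hcB hc hq hφ hπq n hn
      (hπd ▸ Submodule.zero_mem _))

end Strict

end Filtration

section UniversalProperty

lemma existsUnique_algHom_of_graph {R B C : Type*} [CommRing R] [Ring B] [Ring C] [Algebra R B]
    [Algebra R C] {X : Set (B × C)} (hX : Algebra.adjoin R (Prod.fst '' X) = ⊤)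
    (h : ∀ d ∈ Algebra.adjoin R X, d.1 = 0 → d = 0) :
    ∃! ψ : B →ₐ[R] C, ∀ x ∈ X, ψ x.1 = x.2 := by
  let fst : Algebra.adjoin R X →ₐ[R] B :=
    (AlgHom.fst R B C).comp (Algebra.adjoin R X).val
  have fst_injective : Function.Injective fst :=
    (injective_iff_map_eq_zero fst).2 fun d hd => Subtype.ext (h d d.2 hd)
  have fst_surjective : Function.Surjective fst := by
    rw [← AlgHom.range_eq_top, AlgHom.range_comp, Subalgebra.range_val, AlgHom.map_adjoin]
    exact hX
  let e := AlgEquiv.ofBijective fst ⟨fst_injective, fst_surjective⟩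
  let ψ : B →ₐ[R] C :=
    ((AlgHom.snd R B C).comp (Algebra.adjoin R X).val).comp e.symm.toAlgHom
  have ψ_fst (x) (hx : x ∈ X) : ψ x.1 = x.2 :=
    congrArg (fun d : Algebra.adjoin R X => (d : B × C).2)
      (e.symm_apply_apply ⟨x, Algebra.subset_adjoin hx⟩)
  refine ⟨ψ, ψ_fst, fun ψ' hψ' => AlgHom.ext_of_adjoin_eq_top hX ?_⟩
  rintro _ ⟨x, hx, rfl⟩
  exact (hψ' x hx).trans (ψ_fst x hx).symm

variable {A B C I : Type*} [Ring A] [Ring B] [Ring C] [Algebra ℂ C] [Fintype I] {Λ : Matrix I I A}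
  {p : I → B} {q : I → C} {T : I × I → ℂ}

section Prod

variable [Bialgebra ℂ A] [Algebra ℂ B] {ι : A →ₐ[ℂ] B} {φ : A →ₐ[ℂ] C}
  {f : I → I → A →ₗ[ℂ] ℂ} {η : I → A →ₗ[ℂ] ℂ}

lemma CrossRel.prod (hp : CrossRel ι p Λ f η) (hq : CrossRel φ q Λ f η) :
    CrossRel (ι.prod φ) (fun i => (p i, q i)) Λ f η := fun s a =>
  Prod.ext (by simpa [Prod.fst_sum] using hp s a) (by simpa [Prod.snd_sum] using hq s a)

lemma QuadRel.prod [DecidableEq I] (hp : QuadRel ι p Λ f η T) (hq : QuadRel φ q Λ f η T) :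
    QuadRel (ι.prod φ) (fun i => (p i, q i)) Λ f η T := fun k l =>
  Prod.ext (by simpa [Prod.fst_sum] using hp k l) (by simpa [Prod.snd_sum] using hq k l)

end Prod

lemma IsInhomogeneous.existsUnique_lift [DecidableEq I] [HopfAlgebra ℂ A] [Bialgebra ℂ B]
    {ι : A →ₐc[ℂ] B} {φ : A →ₐ[ℂ] C} {f : I → I → A →ₗ[ℂ] ℂ} {η : I → A →ₗ[ℂ] ℂ}
    (hB : IsInhomogeneous Λ ι p) (hΛ : HomogeneousData Λ)
    (hR : Rmat f Λ * Rmat f Λ = 1) (hcB : CrossRel (ι : A →ₐ[ℂ] B) p Λ f η)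
    (hqB : QuadRel (ι : A →ₐ[ℂ] B) p Λ f η T) (hc : CrossRel φ q Λ f η)
    (hq : QuadRel φ q Λ f η T) :
    ∃! ψ : B →ₐ[ℂ] C, (∀ a, ψ ((ι : A →ₐ[ℂ] B) a) = φ a) ∧ ∀ i, ψ (p i) = q i := by
  let Φ : A →ₐ[ℂ] B × C := (ι : A →ₐ[ℂ] B).prod φ
  let Q (i : I) : B × C := (p i, q i)
  have fst_image : Prod.fst '' (Set.range Φ ∪ Set.range Q) = Set.range ι ∪ Set.range p := by
    rw [Set.image_union, ← Set.range_comp, ← Set.range_comp]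
    rfl
  have lift := existsUnique_algHom_of_graph (fst_image ▸ hB.generates) fun d hd =>
    hB.eq_zero_of_map_eq_zero hΛ hR hcB (hcB.prod hc) (hqB.prod hq) (π := AlgHom.fst ℂ B C)
      (fun _ => rfl) (fun _ => rfl) hd
  simpa only [Set.mem_union, or_imp, forall_and, Set.forall_mem_range, AlgHom.prod_apply] using lift

end UniversalProperty

section RMatrixForm

open scoped Matrix.Module

variable {A C I : Type*} [Ring A] [Ring C] [Algebra ℂ C]

lemma scal_mul_apply {l m n : Type*} [Fintype m] (M : Matrix l m ℂ) (X : Matrix m n C) (i : l)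
    (j : n) : (scal C M * X) i j = ∑ x, M i x • X x j := by
  simp only [scal, Matrix.mul_apply, Matrix.map_apply, ← Algebra.smul_def]

lemma mul_scal_apply {l m n : Type*} [Fintype m] (X : Matrix l m C) (M : Matrix m n ℂ) (i : l)
    (j : n) : (X * scal C M) i j = ∑ x, M x j • X i x := by
  simp only [scal, Matrix.mul_apply, Matrix.map_apply, ← Algebra.commutes, ← Algebra.smul_def]

variable [Fintype I]

lemma sum_sumUnit_prod {M : Type*} [AddCommMonoid M] (F : (I ⊕ Unit) × (I ⊕ Unit) → M) :
    ∑ x, F x = ∑ x : I × I, F (Sum.inl x.1, Sum.inl x.2) + ∑ i, F (Sum.inl i, Sum.inr ()) +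
      (∑ i, F (Sum.inr (), Sum.inl i) + F (Sum.inr (), Sum.inr ())) := by
  simp only [Fintype.sum_prod_type, Fintype.sum_sum_type, Finset.sum_add_distrib,
    Finset.univ_unique, Finset.sum_singleton, PUnit.default_eq_unit]
  abel

lemma matrix_smul_sum_smul {m n M : Type*} [Fintype m] [DecidableEq m] [Fintype n]
    [AddCommGroup M] [Module ℂ M] (R : Matrix m m ℂ) (Z : Matrix m n ℂ) (v : n → M) :
    R • (fun x => ∑ s, Z x s • v s) = fun x => ∑ s, (R * Z) x s • v s := by
  ext x
  simp only [Matrix.Module.smul_apply, Matrix.mul_apply, Finset.smul_sum, Finset.sum_smul,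
    smul_smul]
  exact Finset.sum_comm

section Bialg

variable [Bialgebra ℂ A] {Λ : Matrix I I A} {f : I → I → A →ₗ[ℂ] ℂ} {η : I → A →ₗ[ℂ] ℂ}
  {φ : A →ₐ[ℂ] C} {q : I → C} {T : I × I → ℂ}

section NMatrix

variable {n : Type*} [Fintype n] [DecidableEq n] {w : Matrix n n A}

lemma nmat_upper_left_iff (hw : IsRep w) (s : I) (c d : n) (r : I) :
    ((Pmat φ Λ q ⊗ₖ w.map φ) * scal C (Nmat f η w)) (Sum.inl s, c) (d, Sum.inl r) =
        (scal C (Nmat f η w) * (w.map φ ⊗ₖ Pmat φ Λ q)) (Sum.inl s, c) (d, Sum.inl r) ↔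
      φ (∑ t, Λ s t * actL (f t r) (w c d)) = φ (∑ t, actR (f s t) (w c d) * Λ t r) := by
  simp only [hw.actR, hw.actL, Finset.mul_sum, Finset.sum_mul]
  rw [Finset.sum_comm (s := (Finset.univ : Finset I)) (t := (Finset.univ : Finset n))
    (f := fun t c' => f s t (w c c') • w c' d * Λ t r)]
  simp [mul_scal_apply, scal_mul_apply, Fintype.sum_prod_type, Nmat, Pmat, Gmat, Hmat]

lemma nmat_upper_right_iff (hw : IsRep w) (s : I) (c d : n) :
    ((Pmat φ Λ q ⊗ₖ w.map φ) * scal C (Nmat f η w)) (Sum.inl s, c) (d, Sum.inr ()) =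
        (scal C (Nmat f η w) * (w.map φ ⊗ₖ Pmat φ Λ q)) (Sum.inl s, c) (d, Sum.inr ()) ↔
      q s * φ (w c d) = ∑ t, φ (actR (f s t) (w c d)) * q t + φ (actR (η s) (w c d)) -
        ∑ t, φ (Λ s t * actL (η t) (w c d)) := by
  simp only [eq_sub_iff_add_eq, add_comm (q s * φ (w c d)), hw.actR, hw.actL, map_sum,
    Finset.mul_sum, Finset.sum_mul]
  rw [Finset.sum_comm (s := (Finset.univ : Finset I)) (t := (Finset.univ : Finset n))
    (f := fun t c' => φ (f s t (w c c') • w c' d) * q t)]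
  simp [mul_scal_apply, scal_mul_apply, Fintype.sum_prod_type, Nmat, Pmat, Gmat, Hmat,
    Matrix.one_apply, Finset.sum_add_distrib]

end NMatrix

lemma CrossRel.pnRel (hc : CrossRel φ q Λ f η) (hf : Intertwines Λ f) :
    PNRel φ q Λ f η := by
  intro n w hw
  ext ⟨s | ⟨⟩, c⟩ ⟨d, r | ⟨⟩⟩
  · exact (nmat_upper_left_iff hw s c d r).2 (congrArg φ (hf s r _))
  · exact (nmat_upper_right_iff hw s c d).2 (hc s _)
  · simp [mul_scal_apply, scal_mul_apply, Fintype.sum_prod_type, Nmat, Pmat]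
  · simp [mul_scal_apply, scal_mul_apply, Fintype.sum_prod_type, Nmat, Pmat, Matrix.one_apply]

variable [DecidableEq I]

/-- The difference of the two sides of `R_P (𝒫 ⊗ 𝒫) = (𝒫 ⊗ 𝒫) R_P`, whose entries are the
individual relations contained in `RPRel`. -/
def rpDefect (φ : A →ₐ[ℂ] C) (q : I → C) (Λ : Matrix I I A) (f : I → I → A →ₗ[ℂ] ℂ)
    (η : I → A →ₗ[ℂ] ℂ) (T : I × I → ℂ) :
    Matrix ((I ⊕ Unit) × (I ⊕ Unit)) ((I ⊕ Unit) × (I ⊕ Unit)) C :=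
  scal C (RPmat (Rmat f Λ) (Zmat η Λ) T) * (Pmat φ Λ q ⊗ₖ Pmat φ Λ q) -
    (Pmat φ Λ q ⊗ₖ Pmat φ Λ q) * scal C (RPmat (Rmat f Λ) (Zmat η Λ) T)

lemma rpRel_iff_rpDefect_eq_zero : RPRel φ q Λ f η T ↔ rpDefect φ q Λ f η T = 0 :=
  sub_eq_zero.symm

lemma rpDefect_inl_inl (k b : I × I) :
    rpDefect φ q Λ f η T (Sum.inl k.1, Sum.inl k.2) (Sum.inl b.1, Sum.inl b.2) =
      φ ((scal A (Rmat f Λ) * (Λ ⊗ₖ Λ)) k b - ((Λ ⊗ₖ Λ) * scal A (Rmat f Λ)) k b) := by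
  simp [rpDefect, mul_scal_apply, scal_mul_apply, sum_sumUnit_prod, RPmat, Pmat]

lemma rpDefect_inl_inr (k : I × I) (b : I) :
    rpDefect φ q Λ f η T (Sum.inl k.1, Sum.inl k.2) (Sum.inl b, Sum.inr ()) =
      (Rmat f Λ • (fun x : I × I => φ (Λ x.1 b) * q x.2)) k +
        ∑ s, Zmat η Λ k s • φ (Λ s b) -
        φ (coactVec (Λ ⊗ₖ Λ) (fun y => Zmat η Λ y b) k) - q k.1 * φ (Λ k.2 b) := by
  simp [rpDefect, mul_scal_apply, scal_mul_apply, sum_sumUnit_prod, RPmat, Pmat, coactVec_apply,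
    Matrix.one_apply, sub_sub]

lemma rpDefect_inr_inl (k : I × I) (b : I) :
    rpDefect φ q Λ f η T (Sum.inl k.1, Sum.inl k.2) (Sum.inr (), Sum.inl b) =
      (Rmat f Λ • (fun x : I × I => q x.1 * φ (Λ x.2 b))) k -
        ∑ s, (Rmat f Λ * Zmat η Λ) k s • φ (Λ s b) +
        φ (coactVec (Λ ⊗ₖ Λ) (fun y => (Rmat f Λ * Zmat η Λ) y b) k) - φ (Λ k.1 b) * q k.2 := by
  simp only [rpDefect, RPmat, Matrix.one_apply, Pmat, Matrix.sub_apply, scal_mul_apply,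
    Matrix.of_apply, Matrix.kroneckerMap_apply, sum_sumUnit_prod, Prod.mk.eta,
    Matrix.fromBlocks_apply₁₂, Matrix.fromBlocks_apply₁₁, Matrix.map_apply,
    Matrix.fromBlocks_apply₂₁, Matrix.zero_apply, mul_zero, smul_zero, Finset.sum_const_zero,
    add_zero, Matrix.fromBlocks_apply₂₂, one_mul, neg_smul,
    Finset.sum_neg_distrib, mul_scal_apply, ite_smul, one_smul, zero_smul, Finset.sum_ite_eq',
    Finset.mem_univ, ↓reduceIte, Matrix.Module.smul_apply, coactVec_apply, map_sum, map_smul,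
    map_mul]
  abel

lemma rpDefect_inr_inr (k : I × I) :
    rpDefect φ q Λ f η T (Sum.inl k.1, Sum.inl k.2) (Sum.inr (), Sum.inr ()) =
      (Rmat f Λ • (fun x : I × I => q x.1 * q x.2)) k + ∑ s, Zmat η Λ k s • q s -
        ∑ s, (Rmat f Λ * Zmat η Λ) k s • q s + algebraMap ℂ C ((Rmat f Λ - 1).mulVec T k) -
        φ (coactVec (Λ ⊗ₖ Λ) ((Rmat f Λ - 1).mulVec T) k) - q k.1 * q k.2 := by
  simp only [rpDefect, RPmat, Pmat, Matrix.sub_apply, scal_mul_apply, Matrix.of_apply,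
    Matrix.kroneckerMap_apply, sum_sumUnit_prod, Prod.mk.eta, Matrix.fromBlocks_apply₁₂,
    Matrix.fromBlocks_apply₂₂, Matrix.one_apply_eq, mul_one, one_mul, neg_smul,
    Finset.sum_neg_distrib, mul_scal_apply, Matrix.fromBlocks_apply₁₁, Matrix.map_apply,
    zero_smul, Finset.sum_const_zero, add_zero, one_smul, zero_add, Matrix.Module.smul_apply,
    Algebra.algebraMap_eq_smul_one, coactVec_apply, map_sum, map_smul, map_mul]
  abel

lemma rpDefect_inr_inr_eq_quad (hM : IsMor (Λ ⊗ₖ Λ) (Λ ⊗ₖ Λ) (Rmat f Λ)) (k : I × I) :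
    rpDefect φ q Λ f η T (Sum.inl k.1, Sum.inl k.2) (Sum.inr (), Sum.inr ()) =
      ((Rmat f Λ - 1) •
        (quadElem q Λ η + algebraMap ℂ C ∘ T - φ ∘ coactVec (Λ ⊗ₖ Λ) T)) k := by
  have smul_scalar : (Rmat f Λ - 1) • (algebraMap ℂ C ∘ T) =
      algebraMap ℂ C ∘ ((Rmat f Λ - 1).mulVec T) :=
    (comp_matrix_smul (Algebra.linearMap ℂ C) _ _).symm
  have smul_coact : (Rmat f Λ - 1) • (φ ∘ coactVec (Λ ⊗ₖ Λ) T) =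
      φ ∘ coactVec (Λ ⊗ₖ Λ) ((Rmat f Λ - 1).mulVec T) :=
    (comp_matrix_smul φ.toLinearMap _ _).symm.trans
      (congrArg (φ ∘ ·) (hM.sub_one_smul_coactVec T))
  rw [rpDefect_inr_inr, smul_sub, smul_add, smul_scalar, smul_coact, quadElem, smul_sub,
    matrix_smul_sum_smul, Matrix.sub_mul, Matrix.one_mul, sub_smul, one_smul]
  simp only [Pi.sub_apply, Pi.add_apply, Function.comp_apply, Matrix.sub_apply, sub_smul,
    Finset.sum_sub_distrib]
  abel

namespace CrossRel

lemma rpDefect_inl_inr_eq_zero (hc : CrossRel φ q Λ f η) (hΛ : IsRep Λ) (k : I × I) (b : I) :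
    rpDefect φ q Λ f η T (Sum.inl k.1, Sum.inl k.2) (Sum.inl b, Sum.inr ()) = 0 := by
  rw [rpDefect_inl_inr]
  exact sub_eq_zero.2 (congrFun (hc.mul_rep hΛ b) k).symm

lemma rpDefect_inr_inl_eq_zero (hc : CrossRel φ q Λ f η) (hΛ : IsRep Λ)
    (hR : Rmat f Λ * Rmat f Λ = 1) (hM : IsMor (Λ ⊗ₖ Λ) (Λ ⊗ₖ Λ) (Rmat f Λ)) (k : I × I)
    (b : I) : rpDefect φ q Λ f η T (Sum.inl k.1, Sum.inl k.2) (Sum.inr (), Sum.inl b) = 0 := by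
  have smul_coact : Rmat f Λ • (φ ∘ coactVec (Λ ⊗ₖ Λ) (fun y => Zmat η Λ y b)) =
      φ ∘ coactVec (Λ ⊗ₖ Λ) (fun y => (Rmat f Λ * Zmat η Λ) y b) :=
    (comp_matrix_smul φ.toLinearMap _ _).symm.trans (congrArg (φ ∘ ·) (hM.smul_coactVec _))
  rw [rpDefect_inr_inl, hc.mul_rep hΛ, smul_sub, smul_add, smul_smul, hR, one_smul,
    matrix_smul_sum_smul, smul_coact]
  simp only [Pi.sub_apply, Pi.add_apply, Function.comp_apply]
  abel

theorem rpRel_iff (hc : CrossRel φ q Λ f η) (hΛ : IsRep Λ) (hR : Rmat f Λ * Rmat f Λ = 1)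
    (hf : Intertwines Λ f) :
    RPRel φ q Λ f η T ↔ QuadRel φ q Λ f η T := by
  have hM := rmat_isMor hΛ hf
  rw [rpRel_iff_rpDefect_eq_zero, quadRel_iff, funext_iff]
  simp only [← rpDefect_inr_inr_eq_quad hM, Pi.zero_apply]
  refine ⟨fun h k => congrFun (congrFun h _) _, fun h => ?_⟩
  ext ⟨k | ⟨⟩, l | ⟨⟩⟩ ⟨i | ⟨⟩, j | ⟨⟩⟩
  · exact (rpDefect_inl_inl (k, l) (i, j)).trans (by rw [hM, sub_self, map_zero]; rfl)
  · exact hc.rpDefect_inl_inr_eq_zero hΛ (k, l) i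
  · exact hc.rpDefect_inr_inl_eq_zero hΛ hR hM (k, l) j
  · exact h (k, l)
  all_goals simp [rpDefect, mul_scal_apply, scal_mul_apply, sum_sumUnit_prod, RPmat, Pmat,
    Matrix.one_apply]

end CrossRel

end Bialg

variable [HopfAlgebra ℂ A] {Λ : Matrix I I A} {f : I → I → A →ₗ[ℂ] ℂ} {η : I → A →ₗ[ℂ] ℂ}
  {φ : A →ₐ[ℂ] C} {q : I → C}

lemma PNRel.crossRel [DecidableEq I] (h : PNRel φ q Λ f η) (hΛ : HomogeneousData Λ) :
    CrossRel φ q Λ f η := by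
  intro s a
  have maps_eq : LinearMap.mulLeft ℂ (q s) ∘ₗ φ.toLinearMap =
      ∑ t, LinearMap.mulRight ℂ (q t) ∘ₗ φ.toLinearMap ∘ₗ actR (f s t) +
        φ.toLinearMap ∘ₗ actR (η s) -
        ∑ t, φ.toLinearMap ∘ₗ LinearMap.mulLeft ℂ (Λ s t) ∘ₗ actL (η t) := by
    refine linearMap_ext_irrep hΛ.completelyReducible fun n w hw c d => ?_
    simpa using (nmat_upper_right_iff hw.1 s c d).1
      (congrFun (congrFun (h n w hw.1) (Sum.inl s, c)) (d, Sum.inr ()))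
  simpa using LinearMap.congr_fun maps_eq a

end RMatrixForm

lemma IsInhomogeneous.exists_isStructureData {A B I : Type*} [Ring A] [HopfAlgebra ℂ A]
    [Ring B] [Bialgebra ℂ B] [Fintype I] [DecidableEq I] {Λ : Matrix I I A} {ι : A →ₐc[ℂ] B}
    {p : I → B} {f : I → I → A →ₗ[ℂ] ℂ} {h : I → A →ₗ[ℂ] A} (hB : IsInhomogeneous Λ ι p)
    (hΛ : HomogeneousData Λ)
    (hE : IsExchange (ι : A →ₐ[ℂ] B) p (fun s t => actR (f s t)) h) :
    ∃ η : I → A →ₗ[ℂ] ℂ, IsStructureData Λ f η ∧ CrossRel (ι : A →ₐ[ℂ] B) p Λ f η := by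
  obtain ⟨η, rfl⟩ := exists_eq_coboundary hΛ.completelyReducible hΛ.antipode_bijective.1
    (hB.isCocycle_remainder hΛ hE)
  have hf := hB.intertwines_leading hΛ hE
  have hinj := hB.gamMap_injective hΛ
  refine ⟨η, isStructureData_of_mul hf (leading_one hinj hE) (leading_mul hinj hE) ?_,
    crossRel_iff_isExchange.2 hE⟩
  exact coboundary_mul hΛ hf fun s a b => congrArg Prod.snd (hE.map_mul hinj s a b)

end

end InhomQG

theorem corollary3p8 {A : Type u} {B : Type v} {I : Type x} [Ring A]
    [HopfAlgebra ℂ A] [Ring B] [Bialgebra ℂ B] [Fintype I] [DecidableEq I]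
    (Λ : Matrix I I A) (hΛ : InhomQG.HomogeneousData Λ)
    (ι : A →ₐc[ℂ] B) (p : I → B) (hB : InhomQG.IsInhomogeneous Λ ι p) :
    (∃! f : I → I → A →ₗ[ℂ] ℂ, InhomQG.IsLeading (ι : A →ₐ[ℂ] B) p f) ∧
    ∀ f : I → I → A →ₗ[ℂ] ℂ, InhomQG.IsLeading (ι : A →ₐ[ℂ] B) p f →
      InhomQG.IsMaximal (ι : A →ₐ[ℂ] B) p Λ f →
      (∃ (η : I → A →ₗ[ℂ] ℂ) (T : I × I → ℂ), InhomQG.IsStructureData Λ f η ∧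
        InhomQG.CrossRel (ι : A →ₐ[ℂ] B) p Λ f η ∧
        InhomQG.QuadRel (ι : A →ₐ[ℂ] B) p Λ f η T) ∧
      ∀ (η : I → A →ₗ[ℂ] ℂ) (T : I × I → ℂ),
        InhomQG.CrossRel (ι : A →ₐ[ℂ] B) p Λ f η →
        InhomQG.QuadRel (ι : A →ₐ[ℂ] B) p Λ f η T →
        InhomQG.IsUniversalCrossQuad.{w} (ι : A →ₐ[ℂ] B) p Λ f η T ∧
        InhomQG.IsUniversalRMatrix.{w} (ι : A →ₐ[ℂ] B) p Λ f η T := by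
  obtain ⟨f₀, h, hE⟩ := hB.exists_isExchange_leading hΛ
  have leading_unique (f) (hf : InhomQG.IsLeading (ι : A →ₐ[ℂ] B) p f) : f = f₀ :=
    hf.eq (hB.gamMap_injective hΛ) hE.isLeading
  refine ⟨⟨f₀, hE.isLeading, leading_unique⟩, fun f hf hmax => ?_⟩
  obtain rfl := leading_unique f hf
  have hf_int := hB.intertwines_leading hΛ hE
  refine ⟨?_, fun η T hc hq => ⟨⟨⟨hc, hq⟩, fun C _ _ φ q hcC hqC => ?_⟩,
    ⟨hc.pnRel hf_int, (hc.rpRel_iff hΛ.isRep hmax.1 hf_int).2 hq⟩, fun C _ _ φ q hN hRP => ?_⟩⟩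
  · obtain ⟨η, hη, hc⟩ := hB.exists_isStructureData hΛ hE
    obtain ⟨T, hq⟩ := hB.exists_quadRel hΛ hf_int hmax hc
    exact ⟨η, T, hη, hc, hq⟩
  · exact hB.existsUnique_lift hΛ hmax.1 hc hq hcC hqC
  · have hcC := hN.crossRel hΛ
    exact hB.existsUnique_lift hΛ hmax.1 hc hq hcC
      ((hcC.rpRel_iff hΛ.isRep hmax.1 hf_int).1 hRP)
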